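/- Let $k$ be an algebraically closed field of characteristic $0$, and let $(R,\mathfrak m_R)$ be a one-dimensional complete Noetherian local domain which is a $k$-algebra with residue field $k$. Let $K$ be the fraction field of $R$, let $\overline R$ be the integral closure of $R$ in $K$, and let $\mathfrak C_R = R:_K\overline R$ be the conductor. Assume $\mathfrak C_R\subseteq \mathfrak m_R^2$. Let $x_1\in\mathfrak m_R$ generate a reduction of $\mathfrak m_R$, i.e. $x_1\mathfrak m_R^{n}=\mathfrak m_R^{n+1}$ for some $n\ge 0$ (equivalently, $x_1$ has minimal order among the elements of $\mathfrak m_R$ with respect to the valuation of $\overline R\cong k[[t]]$), and put $$S=R\left[\tfrac{\mathfrak C_R}{x_1}\right]=R\left[\tfrac{c}{x_1} : c\in\mathfrak C_R\right]\subseteq K .$$ Let $\omega_R\subseteq R$ be a canonical ideal of $R$, i.e. an ideal that is a canonical module of $R$ (a maximal Cohen–Macaulay module of type one and finite injective dimension), and let $\overline{\mathfrak m_R\omega_R}$ denote the integral closure in $R$ of the ideal $\mathfrak m_R\omega_R$. Then: 1. $S$ is a Cohen–Macaulay local ring, $\omega_R\cap\overline{\mathfrak m_R\omega_R}$ is an $S$-submodule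 of $K$, and it is a canonical module of $S$. 2. The reduced type $s=\dim_k \dfrac{(\mathfrak C_R,x_1)}{(x_1)}$ of $R$ satisfies $$s=\mu_R\left(\frac{\omega_R}{\omega_R\cap\overline{\mathfrak m_R\omega_R}}\right),$$ where $\mu_R(M)$ denotes the minimal number of generators of an $R$-module $M$. -/

import Mathlib

open Polynomial IsLocalRing CategoryTheory

universe u v

/-- `r` is integral over the ideal `I`: it satisfies an equation
`r ^ n + a₁ * r ^ (n - 1) + ⋯ + aₙ = 0` with `n ≥ 1` and `aᵢ ∈ I ^ i`. -/
def IsIntegralOverIdeal {R : Type u} [CommRing R] (I : Ideal R) (r : R) : Prop :=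
  ∃ n : ℕ, 0 < n ∧ ∃ a : ℕ → R, (∀ i, a i ∈ I ^ i) ∧
    r ^ n + ∑ i ∈ Finset.Icc 1 n, a i * r ^ (n - i) = 0

theorem isIntegralOverIdeal_iff_rees {R : Type u} [CommRing R] (I : Ideal R) (r : R) :
    IsIntegralOverIdeal I r ↔ IsIntegral (reesAlgebra I) (monomial 1 r : R[X]) := by
  constructor
  · rintro ⟨n, hn, a, ha, h⟩
    let b : ℕ → reesAlgebra I := fun i => ⟨monomial i (a i), reesAlgebra.monomial_mem.2 (ha i)⟩
    refine ⟨X ^ n + ∑ i ∈ Finset.Icc 1 n, C (b i) * X ^ (n - i), ?_, ?_⟩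
    · apply monic_X_pow_add
      refine (degree_sum_le _ _).trans_lt ?_
      rw [Finset.sup_lt_iff (by exact WithBot.bot_lt_coe n)]
      intro i hi
      refine (degree_C_mul_X_pow_le _ _).trans_lt ?_
      rw [Finset.mem_Icc] at hi
      exact_mod_cast (by omega : n - i < n)
    · rw [eval₂_add, eval₂_finsetSum, eval₂_X_pow]
      have key : ∀ i ∈ Finset.Icc 1 n,
          eval₂ (algebraMap (reesAlgebra I) R[X]) (monomial 1 r) (C (b i) * X ^ (n - i)) =
            monomial n (a i * r ^ (n - i)) := by
        intro i hi
        rw [Finset.mem_Icc] at hi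
        rw [eval₂_mul, eval₂_C, eval₂_X_pow, monomial_pow]
        change monomial i (a i) * _ = _
        rw [monomial_mul_monomial]
        have e : i + 1 * (n - i) = n := by omega
        rw [e]
      rw [Finset.sum_congr rfl key, monomial_pow, one_mul, ← map_sum, ← map_add, h, map_zero]
  · rintro ⟨p, hp, h⟩
    rcases subsingleton_or_nontrivial R with hR | hR
    · exact ⟨1, one_pos, 0, fun i => Submodule.zero_mem _, Subsingleton.elim _ _⟩
    have hn : 0 < p.natDegree := by
      rcases Nat.eq_zero_or_pos p.natDegree with h0 | h0
      · rw [eq_one_of_monic_natDegree_zero hp h0, eval₂_one] at h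
        exact absurd h one_ne_zero
      · exact h0
    refine ⟨p.natDegree, hn, fun i => (p.coeff (p.natDegree - i) : R[X]).coeff i,
      fun i => (p.coeff (p.natDegree - i)).2 i, ?_⟩
    rw [eval₂_eq_sum_range, Finset.sum_range_succ] at h
    have h2 := congrArg (fun q : R[X] => q.coeff p.natDegree) h
    simp only [hp.coeff_natDegree, map_one, one_mul, coeff_add, finsetSum_coeff, coeff_zero,
      monomial_pow, coeff_monomial_same] at h2
    rw [add_comm, ← h2]
    congr 1
    refine Finset.sum_bij' (fun i _ => p.natDegree - i) (fun j _ => p.natDegree - j) ?_ ?_ ?_ ?_ ?_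
    · intro i hi
      rw [Finset.mem_Icc] at hi
      rw [Finset.mem_range]
      omega
    · intro j hj
      rw [Finset.mem_range] at hj
      rw [Finset.mem_Icc]
      omega
    · intro i hi
      rw [Finset.mem_Icc] at hi
      omega
    · intro j hj
      rw [Finset.mem_range] at hj
      omega
    · intro i hi
      rw [Finset.mem_Icc] at hi
      have e : p.natDegree = i + (p.natDegree - i) := by omega
      change _ = ((p.coeff (p.natDegree - i) : R[X]) * _).coeff p.natDegree
      rw [← mul_one (p.natDegree - i), ← C_mul_X_pow_eq_monomial] at *
      simp only [mul_one] at *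
      rw [← mul_assoc, coeff_mul_X_pow', if_pos (by omega), coeff_mul_C]
      congr 2
      omega

/-- The integral closure (in `R`) of an ideal `I` of `R`. -/
def idealIntegralClosure {R : Type u} [CommRing R] (I : Ideal R) : Ideal R where
  carrier := {r | IsIntegralOverIdeal I r}
  zero_mem' := ⟨1, one_pos, 0, fun _ => Submodule.zero_mem _, by simp⟩
  add_mem' {r s} hr hs := by
    rw [Set.mem_ofPred_eq, isIntegralOverIdeal_iff_rees] at *
    rw [map_add]
    exact hr.add hs
  smul_mem' c r hr := by
    rw [Set.mem_ofPred_eq, isIntegralOverIdeal_iff_rees] at *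
    have h : (monomial 1 (c • r) : R[X]) = algebraMap R R[X] c * monomial 1 r := by
      rw [algebraMap_eq, C_mul_monomial, smul_eq_mul]
    rw [h]
    exact (isIntegral_algebraMap (R := reesAlgebra I)
      (x := algebraMap R (reesAlgebra I) c)).mul hr

/-- `J` is a reduction of the ideal `I`. -/
def IsIdealReduction {R : Type u} [CommRing R] (J I : Ideal R) : Prop :=
  J ≤ I ∧ ∃ n : ℕ, J * I ^ n = I ^ (n + 1)

/-- A maximal Cohen-Macaulay module over a local ring: a finitely generated module having a
regular sequence of length `dim R` inside the maximal ideal. -/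
def IsMaximalCohenMacaulay (R : Type u) [CommRing R] [IsLocalRing R]
    (M : Type u) [AddCommGroup M] [Module R M] : Prop :=
  Module.Finite R M ∧ ∃ rs : List R, (∀ r ∈ rs, r ∈ maximalIdeal R) ∧
    RingTheory.Sequence.IsRegular M rs ∧ ringKrullDim R = (rs.length : ℕ)

/-- A canonical module of a Cohen-Macaulay local ring `R` with residue field `κ`: a maximal
Cohen-Macaulay module `M` of type one and of finite injective dimension. The type of `M` is the
`κ`-dimension of `Ext^d(κ, M)` with `d = dim R`, which is its length over `R`. -/
structure IsCanonicalModule (R : Type u) [CommRing R] [IsLocalRing R]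
    (M : Type u) [AddCommGroup M] [Module R M] : Prop where
  isNoetherianRing : IsNoetherianRing R
  isCohenMacaulay : IsMaximalCohenMacaulay R R
  isMaximalCohenMacaulay : IsMaximalCohenMacaulay R M
  type_eq_one : ∃ d : ℕ, ringKrullDim R = d ∧
    Module.length R
      (Abelian.Ext (ModuleCat.of R (ResidueField R)) (ModuleCat.of R M) d) = 1
  finite_injectiveDimension : ∃ n : ℕ, HasInjectiveDimensionLE (ModuleCat.of R M) n

/-- The conductor `R :_K R̄` of `R` in its integral closure `R̄` in the fraction field `K`,
as an ideal of `R`. -/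
def conductorIdeal (R : Type u) [CommRing R] (K : Type u) [Field K] [Algebra R K] : Ideal R :=
  ((1 : Submodule R K) / Subalgebra.toSubmodule (integralClosure R K)).comap
    (Algebra.linearMap R K)

/-- The ring `R[C / x]`, as a subring of the fraction field `K` of `R`, with `C` the conductor. -/
def conductorTransform (R : Type u) [CommRing R] (K : Type u) [Field K] [Algebra R K] (x : R) :
    Subalgebra R K :=
  Algebra.adjoin R {z : K | ∃ c ∈ conductorIdeal R K, z = algebraMap R K c / algebraMap R K x}

/-- The `k`-dimension of `(C, x) / (x)`, with `C` the conductor of `R`. -/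
noncomputable def reducedType (k : Type v) [Field k] (R : Type u) [CommRing R] [Algebra k R]
    (K : Type u) [Field K] [Algebra R K] (x : R) : Cardinal.{u} :=
  Module.rank k
    (↥(conductorIdeal R K ⊔ Ideal.span {x}) ⧸
      (Ideal.span {x}).submoduleOf (conductorIdeal R K ⊔ Ideal.span {x}))

/-- The minimal number of generators of a module. -/
noncomputable def minNumGenerators (R : Type u) [CommRing R] (M : Type u) [AddCommGroup M]
    [Module R M] : Cardinal.{u} :=
  (⊤ : Submodule R M).spanRank

/-! Let Ω be the image of ω in K, let A : B stand for `A / B` inside K, R̄ for the integral closure,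
C for the conductor and m for the maximal ideal of R. Over a one-dimensional Noetherian local
domain, finite injective dimension means at most one, so K/Ω is injective
(`baer_quotient_of_hasInjectiveDimensionLE`). Maps from finitely generated J ⊆ K to K/Ω are then
multiplications (`exists_eq_mk_mul`), so I ↦ Ω : I is an inclusion-reversing involution on finitely
generated submodules of K, where defined, and preserves lengths of quotients (`div_div_eq_self`,
`length_quotient_eq_length_div_quotient_div`).

As Ω : Ω = R, one has C = R : R̄ = Ω : ΩR̄, and dualizing gives Ω : C = ΩR̄. Since x generates a
reduction, mR̄ = xR̄. Hence C/x ⊆ R̄ and, C being an ideal of R̄, S = R + C/x. So Ω : S = Ω ∩ xΩR̄;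
because R̄ is a principal ideal ring, xΩR̄ ∩ R is the integral closure of mω. The module in the
theorem is therefore Ω : S. Injectivity passes from K/Ω over R to K/(Ω : S) over S, and this makes Ω
: S canonical (`isCanonicalModule_of_baer_quotient`). S is local because C ⊆ m² puts every (c/x)² in
C ⊆ m.

For the reduced type, division by x turns (C, x)/(x) into S/R, whose length is that of Ω/(Ω : S) by
duality. Both modules are killed by m, so length, k-dimension and number of generators agree.
Completeness enters through the finiteness of R̄. -/

/-! ### Vanishing of Ext above degree one, and injectivity of the quotient by Ω. -/

section ExtVanishing

variable {R : Type u} [CommRing R]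

theorem ext_eq_zero_of_exact {N₁ N₂ N₃ : Type u} [AddCommGroup N₁] [Module R N₁]
    [AddCommGroup N₂] [Module R N₂] [AddCommGroup N₃] [Module R N₃]
    (f : N₁ →ₗ[R] N₂) (g : N₂ →ₗ[R] N₃) (hf : Function.Injective f)
    (hg : Function.Surjective g) (hfg : Function.Exact f g) (Y : ModuleCat.{u} R) (n : ℕ)
    (h₁ : ∀ e : Abelian.Ext (ModuleCat.of R N₁) Y n, e = 0)
    (h₃ : ∀ e : Abelian.Ext (ModuleCat.of R N₃) Y n, e = 0)
    (e : Abelian.Ext (ModuleCat.of R N₂) Y n) : e = 0 := by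
  let T : ShortComplex (ModuleCat.{u} R) :=
    ModuleCat.shortComplexOfCompEqZero f g hfg.linearMap_comp_eq_zero
  have hT : T.ShortExact := ModuleCat.shortComplex_shortExact T hfg hf hg
  obtain ⟨e', rfl⟩ := Abelian.Ext.contravariant_sequence_exact₂ hT Y e (h₁ _)
  rw [h₃ e', Abelian.Ext.comp_zero]

theorem ext_left_eq_zero_of_exact {N₁ N₂ N₃ : Type u} [AddCommGroup N₁] [Module R N₁]
    [AddCommGroup N₂] [Module R N₂] [AddCommGroup N₃] [Module R N₃]
    (f : N₁ →ₗ[R] N₂) (g : N₂ →ₗ[R] N₃) (hf : Function.Injective f)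
    (hg : Function.Surjective g) (hfg : Function.Exact f g) (Y : ModuleCat.{u} R) (n : ℕ)
    (h₂ : ∀ e : Abelian.Ext (ModuleCat.of R N₂) Y n, e = 0)
    (h₃ : ∀ e : Abelian.Ext (ModuleCat.of R N₃) Y (n + 1), e = 0)
    (e : Abelian.Ext (ModuleCat.of R N₁) Y n) : e = 0 := by
  let T : ShortComplex (ModuleCat.{u} R) :=
    ModuleCat.shortComplexOfCompEqZero f g hfg.linearMap_comp_eq_zero
  have hT : T.ShortExact := ModuleCat.shortComplex_shortExact T hfg hf hg
  obtain ⟨e', rfl⟩ := Abelian.Ext.contravariant_sequence_exact₁ hT Y e (add_comm 1 n) (h₃ _)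
  rw [h₂ e', Abelian.Ext.comp_zero]

theorem ext_right_eq_zero_of_exact {N₁ N₂ N₃ : Type u} [AddCommGroup N₁] [Module R N₁]
    [AddCommGroup N₂] [Module R N₂] [AddCommGroup N₃] [Module R N₃]
    (f : N₁ →ₗ[R] N₂) (g : N₂ →ₗ[R] N₃) (hf : Function.Injective f)
    (hg : Function.Surjective g) (hfg : Function.Exact f g) (Y : ModuleCat.{u} R) (n : ℕ)
    (h₁ : ∀ e : Abelian.Ext (ModuleCat.of R N₁) Y n, e = 0)
    (h₂ : ∀ e : Abelian.Ext (ModuleCat.of R N₂) Y (n + 1), e = 0)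
    (e : Abelian.Ext (ModuleCat.of R N₃) Y (n + 1)) : e = 0 := by
  let T : ShortComplex (ModuleCat.{u} R) :=
    ModuleCat.shortComplexOfCompEqZero f g hfg.linearMap_comp_eq_zero
  have hT : T.ShortExact := ModuleCat.shortComplex_shortExact T hfg hf hg
  obtain ⟨e', rfl⟩ := Abelian.Ext.contravariant_sequence_exact₃ hT Y e (h₂ _) (add_comm 1 n)
  rw [h₁ e', Abelian.Ext.comp_zero]

theorem ext_self_eq_zero (Y : ModuleCat.{u} R) (n : ℕ) (hn : n ≠ 0)
    (e : Abelian.Ext (ModuleCat.of R R) Y n) : e = 0 := by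
  obtain ⟨m, rfl⟩ := Nat.exists_eq_succ_of_ne_zero hn
  have : Projective (ModuleCat.of R R) := by
    rw [← IsProjective.iff_projective]; infer_instance
  exact Abelian.Ext.eq_zero_of_projective e

theorem ext_eq_zero_of_subsingleton (N : Type u) [AddCommGroup N] [Module R N] [Subsingleton N]
    (Y : ModuleCat.{u} R) (n : ℕ) (e : Abelian.Ext (ModuleCat.of R N) Y n) : e = 0 := by
  have h : 𝟙 (ModuleCat.of R N) = 0 :=
    (ModuleCat.isZero_of_subsingleton (ModuleCat.of R N)).eq_of_src _ _
  rw [← Abelian.Ext.mk₀_id_comp e, h, Abelian.Ext.mk₀_zero, Abelian.Ext.zero_comp]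

theorem ext_eq_zero_of_linearEquiv {M N : Type u} [AddCommGroup M] [Module R M]
    [AddCommGroup N] [Module R N] (φ : M ≃ₗ[R] N) (Y : ModuleCat.{u} R) (n : ℕ)
    (h : ∀ e : Abelian.Ext (ModuleCat.of R N) Y n, e = 0)
    (e : Abelian.Ext (ModuleCat.of R M) Y n) : e = 0 := by
  refine ext_eq_zero_of_exact (N₁ := PUnit) 0 φ.toLinearMap
    (Function.injective_of_subsingleton _) φ.surjective ?_ Y n
    (ext_eq_zero_of_subsingleton _ _ _) h e
  intro y
  constructor
  · intro hy
    exact ⟨0, by simpa using (φ.map_eq_zero_iff.mp hy).symm⟩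
  · rintro ⟨z, rfl⟩
    simp

theorem eq_maximalIdeal_of_isPrime [IsLocalRing R] [Ring.DimensionLEOne R] {p : Ideal R} (hp : p.IsPrime)
    (h0 : p ≠ ⊥) : p = maximalIdeal R :=
  eq_maximalIdeal (Ring.DimensionLEOne.maximalOfPrime h0 hp)

variable [IsDomain R]

theorem ext_quotient_span_singleton_eq_zero {x : R} (hx : x ≠ 0) (Y : ModuleCat.{u} R) {n : ℕ}
    (hn : 2 ≤ n) (e : Abelian.Ext (ModuleCat.of R (R ⧸ Ideal.span {x})) Y n) : e = 0 := by
  obtain ⟨m, rfl⟩ : ∃ m, n = m + 1 := ⟨n - 1, by omega⟩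
  refine ext_right_eq_zero_of_exact (LinearMap.mulLeft R x) (Ideal.span {x}).mkQ
    (mul_right_injective₀ hx) (Submodule.mkQ_surjective _) ?_ Y m
    (ext_self_eq_zero Y m (by omega)) (ext_self_eq_zero Y _ (by omega)) e
  intro y
  rw [Submodule.mkQ_apply, Submodule.Quotient.mk_eq_zero, Ideal.mem_span_singleton']
  simp [mul_comm]

variable [IsLocalRing R] [IsNoetherianRing R] [Ring.DimensionLEOne R]

/-- A prime filtration reduces to R/p with p zero or maximal, and R itself is free. The residue
field embeds in R/(x) for some x ≠ 0, where Ext vanishes from degree 2 on; the obstruction from the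
cokernel sits in degree n + 1. -/
theorem ext_eq_zero_of_ext_succ_eq_zero (hR : ¬ IsField R) (Y : ModuleCat.{u} R) {n : ℕ}
    (hn : 2 ≤ n)
    (h : ∀ (M : Type u) [AddCommGroup M] [Module R M] [Module.Finite R M]
      (e : Abelian.Ext (ModuleCat.of R M) Y (n + 1)), e = 0)
    (M : Type u) [AddCommGroup M] [Module R M] [hM : Module.Finite R M]
    (e : Abelian.Ext (ModuleCat.of R M) Y n) : e = 0 := by
  have hk : ∀ e : Abelian.Ext (ModuleCat.of R (R ⧸ maximalIdeal R)) Y n, e = 0 := by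
    obtain ⟨x, hxm, hx⟩ := Submodule.exists_mem_ne_zero_of_ne_bot
      (isField_iff_maximalIdeal_eq.not.mp hR)
    have : Nontrivial (R ⧸ Ideal.span {x}) := Ideal.Quotient.nontrivial_iff.mpr fun h ↦
      Ideal.IsPrime.ne_top' (eq_top_iff.mpr (h ▸ (Ideal.span_singleton_le_iff_mem _).mpr hxm))
    obtain ⟨p, hp⟩ := associatedPrimes.nonempty R (R ⧸ Ideal.span {x})
    obtain ⟨hpp, f, hf⟩ := (isAssociatedPrime_iff_exists_injective_linearMap _ _).mp hp
    have hp0 : x ∈ p := by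
      rw [← Ideal.Quotient.eq_zero_iff_mem]
      apply hf
      rw [map_zero]
      have : (Ideal.Quotient.mk p x) = x • (1 : R ⧸ p) := by
        rw [Algebra.smul_def, mul_one]; rfl
      rw [this, map_smul]
      obtain ⟨y, hy⟩ := Ideal.Quotient.mk_surjective (f 1)
      rw [← hy, Algebra.smul_def]
      change Ideal.Quotient.mk _ x * _ = 0
      rw [Ideal.Quotient.eq_zero_iff_mem.mpr (Ideal.mem_span_singleton_self x), zero_mul]
    obtain rfl := eq_maximalIdeal_of_isPrime hpp (fun h ↦ hx (by simpa [h] using hp0))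
    exact ext_left_eq_zero_of_exact f (LinearMap.range f).mkQ hf (Submodule.mkQ_surjective _)
      f.exact_map_mkQ_range Y n (ext_quotient_span_singleton_eq_zero hx Y hn) (h _)
  induction hM using IsNoetherianRing.induction_on_isQuotientEquivQuotientPrime R with
  | subsingleton N => exact ext_eq_zero_of_subsingleton N Y n e
  | quotient N p φ =>
    refine ext_eq_zero_of_linearEquiv φ Y n ?_ e
    by_cases hp : p.1 = ⊥
    · exact ext_eq_zero_of_linearEquiv (Submodule.quotEquivOfEqBot _ hp) Y n
        (ext_self_eq_zero Y n (by omega))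
    · rw [eq_maximalIdeal_of_isPrime p.2 hp]
      exact hk
  | exact N₁ N₂ N₃ f g hf hg hfg h₁ h₃ => exact ext_eq_zero_of_exact f g hf hg hfg Y n h₁ h₃ e

/-- Over a one-dimensional Noetherian local domain, finite injective dimension is at most one. -/
theorem ext_eq_zero_of_hasInjectiveDimensionLE (hR : ¬ IsField R) (Y : ModuleCat.{u} R) (d : ℕ)
    [hd : HasInjectiveDimensionLE Y d] {n : ℕ} (hn : 2 ≤ n)
    (M : Type u) [AddCommGroup M] [Module R M] [Module.Finite R M]
    (e : Abelian.Ext (ModuleCat.of R M) Y n) : e = 0 := by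
  -- Descending induction on the degree: `j` bounds how far `n` lies below `d + 1`.
  obtain ⟨j, hj⟩ : ∃ j, d + 1 ≤ n + j := ⟨d + 1, by omega⟩
  induction j generalizing n M with
  | zero => exact Abelian.Ext.eq_zero_of_hasInjectiveDimensionLT e (d + 1) hj
  | succ j ih =>
    exact ext_eq_zero_of_ext_succ_eq_zero hR Y hn
      (fun N _ _ _ e ↦ ih (by omega) N e (by omega)) M e

/-- Ext¹(I, Ω) vanishes because it embeds in Ext²(R/I, Ω) = 0. So a map I → E/Ω lifts to E, and the
lift extends to R. -/
theorem baer_quotient_of_hasInjectiveDimensionLE (hR : ¬ IsField R) {E : Type u} [AddCommGroup E]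
    [Module R E] (hE : Module.Baer R E) (Ω : Submodule R E) (d : ℕ)
    (hd : HasInjectiveDimensionLE (ModuleCat.of R Ω) d) : Module.Baer R (E ⧸ Ω) := by
  intro I f
  have h1 : ∀ e : Abelian.Ext (ModuleCat.of R I) (ModuleCat.of R Ω) 1, e = 0 :=
    ext_left_eq_zero_of_exact I.subtype I.mkQ I.subtype_injective (Submodule.mkQ_surjective _)
      (LinearMap.exact_subtype_mkQ I) _ 1 (ext_self_eq_zero _ 1 one_ne_zero)
      (ext_eq_zero_of_hasInjectiveDimensionLE hR _ d le_rfl _)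
  let T : ShortComplex (ModuleCat.{u} R) := ModuleCat.shortComplexOfCompEqZero Ω.subtype Ω.mkQ
    (LinearMap.exact_subtype_mkQ Ω).linearMap_comp_eq_zero
  have hT : T.ShortExact := ModuleCat.shortComplex_shortExact T (LinearMap.exact_subtype_mkQ Ω)
    Ω.subtype_injective (Submodule.mkQ_surjective _)
  obtain ⟨g, hg⟩ := Abelian.Ext.covariant_sequence_exact₃ (ModuleCat.of R I) hT
    (Abelian.Ext.mk₀ (ModuleCat.ofHom f)) (zero_add 1) (h1 _)
  obtain ⟨g, rfl⟩ := Abelian.Ext.homEquiv₀.symm.surjective g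
  have hg' : g ≫ T.g = ModuleCat.ofHom f := by
    apply Abelian.Ext.homEquiv₀.symm.injective
    exact (Abelian.Ext.mk₀_comp_mk₀ g T.g).symm.trans hg
  obtain ⟨φ, hφ⟩ := hE I g.hom
  refine ⟨Ω.mkQ ∘ₗ φ, fun y hy ↦ ?_⟩
  have := congrArg (fun q ↦ q.hom ⟨y, hy⟩) hg'
  rw [LinearMap.comp_apply, hφ y hy]
  exact this

end ExtVanishing

/-! ### Duality of fractional ideals with respect to Ω. -/

section Duality

variable {R : Type*} [CommRing R] {K : Type*} [Field K] [Algebra R K]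
  [IsFractionRing R K]

/-- The fraction field of a domain is an injective module. -/
theorem baer_fractionRing (R : Type*) [CommRing R] [IsDomain R] (K : Type*) [Field K]
    [Algebra R K] [IsFractionRing R K] : Module.Baer R K := by
  intro I f
  by_cases hI : I = ⊥
  · refine ⟨0, fun y hy ↦ ?_⟩
    have : (⟨y, hy⟩ : I) = 0 := by ext; simpa [hI] using hy
    rw [this, map_zero, LinearMap.zero_apply]
  obtain ⟨a, ha, ha0⟩ := Submodule.exists_mem_ne_zero_of_ne_bot hI
  have ha' : algebraMap R K a ≠ 0 := by simpa using ha0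
  refine ⟨LinearMap.toSpanSingleton R K (f ⟨a, ha⟩ / algebraMap R K a), fun y hy ↦ ?_⟩
  have h : y • (⟨a, ha⟩ : I) = a • ⟨y, hy⟩ := by ext; simp [mul_comm]
  have := congrArg f h
  simp only [map_smul, Algebra.smul_def] at this
  rw [LinearMap.toSpanSingleton_apply, Algebra.smul_def, ← mul_div_assoc, this,
    mul_div_cancel_left₀ _ ha']

variable {Ω : Submodule R K}

section

variable [IsLocalRing R] [IsNoetherianRing R] [Ring.DimensionLEOne R]

/-- The socle of K/Ω is nonzero: K/Ω is torsion, so its associated primes are nonzero, hence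
maximal. -/
theorem exists_notMem_forall_smul_mem (hΩ0 : Ω ≠ ⊥) (hΩ : Ω ≠ ⊤) :
    ∃ u : K, u ∉ Ω ∧ ∀ r ∈ maximalIdeal R, r • u ∈ Ω := by
  have : Nontrivial (K ⧸ Ω) := Submodule.Quotient.nontrivial_iff.mpr hΩ
  obtain ⟨p, hp⟩ := associatedPrimes.nonempty R (K ⧸ Ω)
  obtain ⟨hpp, u, hu⟩ := isAssociatedPrime_iff.mp hp
  obtain ⟨u, rfl⟩ := Ω.mkQ_surjective u
  have hmem : ∀ r, r ∈ p ↔ r • u ∈ Ω := by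
    intro r
    rw [hu, Submodule.mem_colon_singleton, Submodule.mem_bot, ← map_smul, Submodule.mkQ_apply,
      Submodule.Quotient.mk_eq_zero]
  have hp0 : p ≠ ⊥ := by
    obtain ⟨w, hw, hw0⟩ := Submodule.exists_mem_ne_zero_of_ne_bot hΩ0
    obtain ⟨a, b, hb, hab⟩ := IsFractionRing.div_surjective (A := R) (u / w)
    have hb0 : algebraMap R K b ≠ 0 :=
      IsLocalization.to_map_ne_zero_of_mem_nonZeroDivisors K le_rfl hb
    intro h
    have : b ∈ p := by
      rw [hmem, Algebra.smul_def]
      have : algebraMap R K b * u = a • w := by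
        rw [Algebra.smul_def]
        field_simp at hab
        linear_combination -hab
      rw [this]
      exact Ω.smul_mem _ hw
    rw [h, Submodule.mem_bot] at this
    simp [this] at hb0
  rw [eq_maximalIdeal_of_isPrime hpp hp0] at hmem
  refine ⟨u, fun h ↦ ?_, fun r hr ↦ (hmem r).mp hr⟩
  have := (hmem 1).mpr (by rwa [one_smul])
  exact (Ideal.ne_top_iff_one _).mp Ideal.IsPrime.ne_top' this

end

variable [IsDomain R]

/-- If `K ⧸ Ω` is injective, a map from a fractional ideal to `K ⧸ Ω` is a multiplication. -/
theorem exists_eq_mk_mul (hΩ : Module.Baer R (K ⧸ Ω)) {J : Submodule R K} (hJ : J.FG)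
    (f : J →ₗ[R] K ⧸ Ω) : ∃ y : K, ∀ j : J, f j = Ω.mkQ (y * j) := by
  obtain ⟨d, hd, hdJ⟩ := FractionalIdeal.isFractional_of_fg (S := nonZeroDivisors R) hJ
  have hd0 : algebraMap R K d ≠ 0 := IsLocalization.to_map_ne_zero_of_mem_nonZeroDivisors K le_rfl hd
  -- `μ` is division by the common denominator `d`. It replaces `J` by an ideal of R, to which the
  -- Baer property applies.
  let μ : R →ₗ[R] K := LinearMap.toSpanSingleton R K (algebraMap R K d)⁻¹
  have hμ : ∀ r, μ r = algebraMap R K r / algebraMap R K d := fun r ↦ by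
    simp [μ, Algebra.smul_def, div_eq_mul_inv]
  let I : Ideal R := J.comap μ
  obtain ⟨g, hg⟩ := hΩ I (f ∘ₗ μ.restrict (p := I) (q := J) fun r hr ↦ hr)
  obtain ⟨z, hz⟩ := Ω.mkQ_surjective (g 1)
  refine ⟨z * algebraMap R K d, fun j ↦ ?_⟩
  obtain ⟨r, hr⟩ := hdJ j j.2
  have hrj : μ r = j := by
    rw [hμ, hr, Algebra.smul_def, mul_div_cancel_left₀ _ hd0]
  have hrI : r ∈ I := by
    change μ r ∈ J
    rw [hrj]; exact j.2
  have h := hg r hrI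
  have e1 : (f ∘ₗ μ.restrict (p := I) (q := J) fun r hr ↦ hr) ⟨r, hrI⟩ = f j := by
    rw [LinearMap.comp_apply]
    congr 1
    ext
    exact hrj
  rw [e1] at h
  rw [← h, ← mul_one r, ← smul_eq_mul, map_smul, ← hz, ← map_smul, mul_assoc, ← Algebra.smul_def,
    ← hr, mul_comm, Algebra.smul_def]

variable [IsLocalRing R] [IsNoetherianRing R] [Ring.DimensionLEOne R]

/-- Fractional ideals are reflexive with respect to `Ω` when `K ⧸ Ω` is injective. -/
theorem div_div_eq_self (hΩ : Module.Baer R (K ⧸ Ω)) (hΩ0 : Ω ≠ ⊥) (hΩ1 : Ω ≠ ⊤)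
    {I : Submodule R K} (hI : I.FG) : Ω / (Ω / I) = I := by
  refine le_antisymm (fun z hz ↦ ?_) fun z hz ↦ ?_
  swap
  · rw [Submodule.mem_div_iff_forall_mul_mem]
    intro y hy
    rw [mul_comm]
    exact Submodule.mem_div_iff_forall_mul_mem.mp hy z hz
  by_contra hzI
  obtain ⟨u, hu, hmu⟩ := exists_notMem_forall_smul_mem hΩ0 hΩ1
  -- If z ∉ I, the annihilator of z modulo I lies in the maximal ideal, which kills the socle
  -- element u. So z ↦ u defines a map J/I → K/Ω. It is multiplication by some y; vanishing on I
  -- gives y ∈ Ω : I, while yz ≡ u ∉ Ω contradicts z ∈ Ω : (Ω : I).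
  let J := I ⊔ R ∙ z
  let g : R →ₗ[R] K ⧸ I := LinearMap.toSpanSingleton R _ (I.mkQ z)
  let h : R →ₗ[R] K ⧸ Ω := LinearMap.toSpanSingleton R _ (Ω.mkQ u)
  have hgh : LinearMap.ker g ≤ LinearMap.ker h := by
    intro r hr
    have hr1 : r • z ∈ I := by
      rwa [LinearMap.mem_ker, LinearMap.toSpanSingleton_apply, ← map_smul, Submodule.mkQ_apply,
        Submodule.Quotient.mk_eq_zero] at hr
    rw [LinearMap.mem_ker, LinearMap.toSpanSingleton_apply, ← map_smul, Submodule.mkQ_apply,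
        Submodule.Quotient.mk_eq_zero]
    apply hmu
    rw [mem_maximalIdeal, mem_nonunits_iff]
    intro hr2
    exact hzI ((I.smul_mem_iff_of_isUnit hr2).mp hr1)
  let φ : LinearMap.range g →ₗ[R] K ⧸ Ω :=
    (LinearMap.ker g).liftQ h hgh ∘ₗ g.quotKerEquivRange.symm.toLinearMap
  have hφ : ∀ (r : R) (hr : r • I.mkQ z ∈ LinearMap.range g), φ ⟨_, hr⟩ = Ω.mkQ (r • u) := by
    intro r hr
    have : g.quotKerEquivRange.symm ⟨r • I.mkQ z, hr⟩ = (LinearMap.ker g).mkQ r := by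
      rw [LinearEquiv.symm_apply_eq]
      rfl
    change (LinearMap.ker g).liftQ h hgh (g.quotKerEquivRange.symm ⟨r • I.mkQ z, hr⟩) = _
    rw [this]
    rfl
  have hJ : ∀ j ∈ J, I.mkQ j ∈ LinearMap.range g := by
    intro j hj
    obtain ⟨i, hi, w, hw, rfl⟩ := Submodule.mem_sup.mp hj
    obtain ⟨r, rfl⟩ := Submodule.mem_span_singleton.mp hw
    refine ⟨r, ?_⟩
    rw [map_add, map_smul, Submodule.mkQ_apply, (Submodule.Quotient.mk_eq_zero I).mpr hi, zero_add]
    rfl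
  obtain ⟨y, hy⟩ := exists_eq_mk_mul hΩ (hI.sup (Submodule.fg_span_singleton z))
    (φ ∘ₗ I.mkQ.restrict (p := J) hJ)
  have hyI : y ∈ Ω / I := by
    rw [Submodule.mem_div_iff_forall_mul_mem]
    intro i hi
    have := hy ⟨i, Submodule.mem_sup_left hi⟩
    rw [← Submodule.Quotient.mk_eq_zero, ← Submodule.mkQ_apply, ← this, LinearMap.comp_apply]
    convert map_zero φ
    exact Subtype.ext ((Submodule.Quotient.mk_eq_zero I).mpr hi)
  have hzJ : z ∈ J := Submodule.mem_sup_right (Submodule.mem_span_singleton_self z)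
  have h1 := hy ⟨z, hzJ⟩
  have h2 : (φ ∘ₗ I.mkQ.restrict (p := J) hJ) ⟨z, hzJ⟩ = Ω.mkQ u := by
    have hr : (1 : R) • I.mkQ z ∈ LinearMap.range g := ⟨1, rfl⟩
    have h3 := hφ 1 hr
    rw [one_smul R u] at h3
    rw [← h3, LinearMap.comp_apply]
    congr 1
    ext
    exact (one_smul R (I.mkQ z)).symm
  rw [h2] at h1
  apply hu
  have h4 := Submodule.mem_div_iff_forall_mul_mem.mp hz y hyI
  rw [mul_comm, ← Submodule.Quotient.mk_eq_zero, ← Submodule.mkQ_apply] at h4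
  rwa [← Submodule.Quotient.mk_eq_zero, ← Submodule.mkQ_apply, h1]

/-- Submodules of `J ⧸ I` correspond to submodules between `I` and `J`. -/
def Submodule.quotientSubmoduleOfOrderIso {R M : Type*} [Ring R] [AddCommGroup M] [Module R M]
    (I J : Submodule R M) (h : I ≤ J) :
    Submodule R (J ⧸ I.submoduleOf J) ≃o Set.Icc I J where
  toFun N := ⟨(N.comap (I.submoduleOf J).mkQ).map J.subtype, by
    refine ⟨fun i hi ↦ ⟨⟨i, h hi⟩, ?_, rfl⟩, Submodule.map_subtype_le _ _⟩
    change (I.submoduleOf J).mkQ _ ∈ N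
    convert N.zero_mem
    exact (Submodule.Quotient.mk_eq_zero _).mpr (Submodule.mem_comap.mpr hi)⟩
  invFun X := (X.1.comap J.subtype).map (I.submoduleOf J).mkQ
  left_inv N := by
    dsimp only
    rw [Submodule.comap_map_eq_of_injective J.subtype_injective,
      Submodule.map_comap_eq_of_surjective (Submodule.mkQ_surjective _)]
  right_inv X := by
    ext1
    dsimp only
    rw [Submodule.comap_map_mkQ, sup_eq_right.mpr (Submodule.comap_mono X.2.1),
      Submodule.map_comap_subtype, inf_eq_right.mpr X.2.2]
  map_rel_iff' {N N'} := by
    change Submodule.map _ _ ≤ Submodule.map _ _ ↔ _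
    rw [Submodule.map_le_map_iff_of_injective J.subtype_injective,
      Submodule.comap_le_comap_iff_of_surjective (Submodule.mkQ_surjective _)]

theorem Submodule.div_le_div_left {R A : Type*} [CommSemiring R] [CommSemiring A] [Algebra R A]
    {I J : Submodule R A} (Ω : Submodule R A) (h : I ≤ J) : Ω / J ≤ Ω / I := fun _ hz ↦
  Submodule.mem_div_iff_forall_mul_mem.mpr fun y hy ↦
    Submodule.mem_div_iff_forall_mul_mem.mp hz y (h hy)

/-- Duality with respect to `Ω` preserves lengths of quotients of fractional ideals. -/
theorem length_quotient_eq_length_div_quotient_div (hΩ : Module.Baer R (K ⧸ Ω)) (hΩ0 : Ω ≠ ⊥)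
    (hΩ1 : Ω ≠ ⊤) {I J : Submodule R K} (hIJ : I ≤ J) (hJ : J.FG) (hI : (Ω / I).FG) :
    Module.length R (J ⧸ I.submoduleOf J) =
      Module.length R (↥(Ω / I) ⧸ (Ω / J).submoduleOf (Ω / I)) := by
  have fg_of_le {A B : Submodule R K} (hA : A.FG) (h : B ≤ A) : B.FG := by
    have := isNoetherian_of_fg_of_noetherian A hA
    exact (isNoetherian_submodule.mp this) B h
  have dd {X : Submodule R K} (hX : X.FG) : Ω / (Ω / X) = X := div_div_eq_self hΩ hΩ0 hΩ1 hX
  -- Length is the Krull dimension of the lattice of submodules, which is unchanged when the order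
  -- is reversed.
  let e : Set.Icc I J ≃o (Set.Icc (Ω / J) (Ω / I))ᵒᵈ :=
    { toFun X := OrderDual.toDual
        ⟨Ω / X.1, Submodule.div_le_div_left Ω X.2.2, Submodule.div_le_div_left Ω X.2.1⟩
      invFun Y := ⟨Ω / (OrderDual.ofDual Y).1, by
        conv_lhs => rw [← dd (fg_of_le hJ hIJ)]
        exact Submodule.div_le_div_left Ω (OrderDual.ofDual Y).2.2, by
        conv_rhs => rw [← dd hJ]
        exact Submodule.div_le_div_left Ω (OrderDual.ofDual Y).2.1⟩
      left_inv X := Subtype.ext (dd (fg_of_le hJ X.2.2))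
      right_inv Y := by
        apply OrderDual.ofDual.injective
        exact Subtype.ext (dd (fg_of_le hI (OrderDual.ofDual Y).2.2))
      map_rel_iff' {X Y} := by
        change Ω / Y.1 ≤ Ω / X.1 ↔ X.1 ≤ Y.1
        refine ⟨fun h ↦ ?_, Submodule.div_le_div_left Ω⟩
        have := Submodule.div_le_div_left Ω h
        rwa [dd (fg_of_le hJ X.2.2), dd (fg_of_le hJ Y.2.2)] at this }
  apply WithBot.coe_injective
  rw [Module.coe_length, Module.coe_length,
    Order.krullDim_eq_of_orderIso (Submodule.quotientSubmoduleOfOrderIso I J hIJ),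
    Order.krullDim_eq_of_orderIso (Submodule.quotientSubmoduleOfOrderIso (Ω / J) (Ω / I)
      (Submodule.div_le_div_left Ω hIJ)),
    Order.krullDim_eq_of_orderIso e, Order.krullDim_orderDual]

end Duality

/-! ### From injectivity of K/W to canonical modules. -/

section Canonical

theorem dimensionLEOne_of_ringKrullDim_eq_one {R : Type*} [CommRing R] [IsDomain R]
    (h : ringKrullDim R = 1) : Ring.DimensionLEOne R where
  maximalOfPrime {p} hp0 hp := by
    have : Ring.KrullDimLE 1 R := Ring.krullDimLE_iff.mpr (by rw [h]; rfl)
    exact hp.isMaximal_of_ne_bot hp0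

theorem not_isField_of_ringKrullDim_eq_one {R : Type*} [CommRing R]
    (h : ringKrullDim R = 1) : ¬ IsField R := fun hR ↦ by
  rw [ringKrullDim_eq_zero_of_isField hR] at h
  exact zero_ne_one h

theorem ringKrullDim_eq_one_of_dimensionLEOne {R : Type*} [CommRing R] [IsDomain R]
    [Ring.DimensionLEOne R] (hR : ¬ IsField R) : ringKrullDim R = 1 := by
  have h1 : ringKrullDim R ≤ 1 := Ring.krullDimLE_iff.mp (inferInstanceAs (Ring.KrullDimLE 1 R))
  refine le_antisymm h1 ?_
  by_contra h
  apply hR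
  have : Ring.KrullDimLE 0 R := by
    rw [Ring.krullDimLE_iff]
    cases hd : ringKrullDim R with
    | bot => exact bot_le
    | coe d =>
      rw [hd] at h
      norm_cast at h ⊢
      exact (Order.lt_one_iff.mp (not_le.mp h)).le
  exact Ring.KrullDimLE.isField_of_isDomain

theorem Submodule.ne_top_of_fg_of_isFractionRing {R : Type*} [CommRing R] [IsDomain R]
    {K : Type*} [Field K] [Algebra R K] [IsFractionRing R K] (hR : ¬ IsField R)
    {Ω : Submodule R K} (hΩ : Ω.FG) : Ω ≠ ⊤ := by
  rintro rfl
  obtain ⟨d, hd, hdJ⟩ := FractionalIdeal.isFractional_of_fg (S := nonZeroDivisors R) hΩ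
  have hd0 : algebraMap R K d ≠ 0 :=
    IsLocalization.to_map_ne_zero_of_mem_nonZeroDivisors K le_rfl hd
  apply hR
  have hs : Function.Surjective (algebraMap R K) := fun z ↦ by
    obtain ⟨r, hr⟩ := hdJ (z / algebraMap R K d) trivial
    exact ⟨r, by rw [hr, Algebra.smul_def, mul_div_cancel₀ _ hd0]⟩
  exact (RingEquiv.ofBijective _ ⟨IsFractionRing.injective R K, hs⟩).toMulEquiv.isField
    (Field.toIsField K)

/-- Composing an S-linear map I → K/W with K/W → K/Ω gives a multiplication by some y. As W = Ω : S,
comparing modulo Ω after multiplying by every s ∈ S recovers the map modulo W. -/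
theorem baer_quotient_of_subalgebra {R : Type*} [CommRing R] [IsDomain R] [IsNoetherianRing R]
    {K : Type*} [Field K] [Algebra R K] [IsFractionRing R K] {Ω : Submodule R K}
    (hΩ : Module.Baer R (K ⧸ Ω)) (S : Subalgebra R K) [Module.Finite R S] (W : Submodule S K)
    (hW : W.restrictScalars R = Ω / Subalgebra.toSubmodule S) : Module.Baer S (K ⧸ W) := by
  have memW : ∀ z, z ∈ W ↔ ∀ s ∈ S, z * s ∈ Ω := fun z ↦ by
    rw [← Submodule.restrictScalars_mem R W, hW, Submodule.mem_div_iff_forall_mul_mem]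
    rfl
  intro I f
  have hWΩ : W.restrictScalars R ≤ Ω := fun z hz ↦ by
    simpa using (memW z).mp hz 1 S.one_mem
  let π : (K ⧸ W) →ₗ[R] K ⧸ Ω := (W.restrictScalars R).mapQ Ω LinearMap.id hWΩ ∘ₗ
    (Submodule.Quotient.restrictScalarsEquiv R W).symm.toLinearMap
  have hπ : ∀ z, π (W.mkQ z) = Ω.mkQ z := fun z ↦ rfl
  let J : Submodule R K := (I.restrictScalars R).map S.val.toLinearMap
  have hJ : J.FG := by
    refine Submodule.FG.map _ ?_
    have : IsNoetherian R S := inferInstance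
    exact IsNoetherian.noetherian _
  let e : I.restrictScalars R ≃ₗ[R] J :=
    Submodule.equivMapOfInjective S.val.toLinearMap Subtype.val_injective _
  have he : ∀ i : I, (e i : K) = (i : S) := fun i ↦ rfl
  obtain ⟨y, hy⟩ := exists_eq_mk_mul hΩ hJ (π ∘ₗ f.restrictScalars R ∘ₗ e.symm.toLinearMap)
  have hy' : ∀ i : I, π (f i) = Ω.mkQ (y * (i : S)) := fun i ↦ by
    rw [← he, ← hy (e i), LinearMap.comp_apply, LinearMap.comp_apply]
    exact congrArg (fun j : I ↦ π (f j)) (e.symm_apply_apply i).symm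
  refine ⟨LinearMap.toSpanSingleton S _ (W.mkQ y), fun i hi ↦ ?_⟩
  obtain ⟨z, hz⟩ := W.mkQ_surjective (f ⟨i, hi⟩)
  rw [LinearMap.toSpanSingleton_apply, ← map_smul, ← hz, Submodule.mkQ_apply, Submodule.mkQ_apply,
    Submodule.Quotient.eq, memW]
  intro s hs
  have h1 := hy' ((⟨s, hs⟩ : S) • ⟨i, hi⟩)
  rw [map_smul, ← hz, ← map_smul, hπ, Submodule.mkQ_apply, Submodule.mkQ_apply,
    Submodule.Quotient.eq] at h1
  rw [← neg_mem_iff]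
  convert h1 using 1
  simp only [Subalgebra.smul_def, smul_eq_mul, SetLike.val_smul, MulMemClass.coe_mul]
  ring

theorem shortExact_quotient {S : Type u} [CommRing S] {M : Type u} [AddCommGroup M] [Module S M] (W : Submodule S M) :
    (ModuleCat.shortComplexOfCompEqZero W.subtype W.mkQ
      (LinearMap.exact_subtype_mkQ W).linearMap_comp_eq_zero).ShortExact :=
  ModuleCat.shortComplex_shortExact _ (LinearMap.exact_subtype_mkQ W)
    W.subtype_injective (Submodule.mkQ_surjective _)

section

variable {S : Type u} [CommRing S] [IsDomain S] {K : Type u} [Field K] [Algebra S K]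
  [IsFractionRing S K] {W : Submodule S K}

theorem hasInjectiveDimensionLE_one_of_baer_quotient (hW : Module.Baer S (K ⧸ W)) :
    HasInjectiveDimensionLE (ModuleCat.of S W) 1 := by
  have h2 : Injective (ModuleCat.of S K) := by
    rw [← Module.injective_iff_injective_object, ← Module.Baer.iff_injective]
    exact baer_fractionRing S K
  have h3 : Injective (ModuleCat.of S (K ⧸ W)) := by
    rw [← Module.injective_iff_injective_object, ← Module.Baer.iff_injective]
    exact hW
  exact (shortExact_quotient W).hasInjectiveDimensionLT_X₁ 1
    (injective_iff_hasInjectiveDimensionLT_one.mp h3)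
    (hasInjectiveDimensionLT_of_ge _ 1 2 (by norm_num))

variable [IsLocalRing S] [IsNoetherianRing S] [Ring.DimensionLEOne S]

/-- The socle of K/W is generated by any nonzero element u. If y ∈ W : (W + Su), then y ∈ W : W = S,
and y is a non-unit because yu ∈ W. Hence vy ∈ W, so v ∈ W : (W : (W + Su)) = W + Su. -/
theorem exists_sub_smul_mem (hS : ¬ IsField S) (hW : Module.Baer S (K ⧸ W)) (hfg : W.FG)
    (h0 : W ≠ ⊥) {u v : K} (hu : u ∉ W) (hv : ∀ r ∈ maximalIdeal S, r • v ∈ W) :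
    ∃ s : S, v - s • u ∈ W := by
  have h1 : W ≠ ⊤ := Submodule.ne_top_of_fg_of_isFractionRing hS hfg
  have hN : v ∈ W / (W / (W ⊔ S ∙ u)) := by
    rw [Submodule.mem_div_iff_forall_mul_mem]
    intro y hy
    rw [Submodule.mem_div_iff_forall_mul_mem] at hy
    have hyS : y ∈ W / (W / (1 : Submodule S K)) := by
      rw [Submodule.mem_div_iff_forall_mul_mem]
      intro w hw
      refine hy w (Submodule.mem_sup_left ?_)
      simpa using Submodule.mem_div_iff_forall_mul_mem.mp hw 1 (Submodule.one_le.mp le_rfl)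
    rw [div_div_eq_self hW h0 h1 (Submodule.one_eq_span (R := S) (A := K) ▸
      Submodule.fg_span_singleton _)] at hyS
    obtain ⟨s, rfl⟩ := Submodule.mem_one.mp hyS
    rw [mul_comm, ← Algebra.smul_def]
    apply hv
    rw [mem_maximalIdeal, mem_nonunits_iff]
    intro hs
    have := hy u (Submodule.mem_sup_right (Submodule.mem_span_singleton_self u))
    rw [← Algebra.smul_def] at this
    exact hu ((W.smul_mem_iff_of_isUnit hs).mp this)
  rw [div_div_eq_self hW h0 h1 (hfg.sup (Submodule.fg_span_singleton _))] at hN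
  obtain ⟨w, hw, t, ht, rfl⟩ := Submodule.mem_sup.mp hN
  obtain ⟨s, rfl⟩ := Submodule.mem_span_singleton.mp ht
  exact ⟨s, by simpa using hw⟩

theorem isSimpleModule_residueField_hom (hS : ¬ IsField S) (hW : Module.Baer S (K ⧸ W))
    (hfg : W.FG) (h0 : W ≠ ⊥) : IsSimpleModule S (ResidueField S →ₗ[S] K ⧸ W) := by
  have hker : ∀ (g : ResidueField S →ₗ[S] K ⧸ W), ∀ r ∈ maximalIdeal S, r • g 1 = 0 := by
    intro g r hr
    rw [← map_smul]
    convert map_zero g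
    rw [Algebra.smul_def, mul_one]
    exact Ideal.Quotient.eq_zero_iff_mem.mpr hr
  have hval : ∀ (g : ResidueField S →ₗ[S] K ⧸ W) (r : S), g (residue S r) = r • g 1 := by
    intro g r
    rw [← map_smul, Algebra.smul_def, mul_one]
    rfl
  have hext : ∀ (g g' : ResidueField S →ₗ[S] K ⧸ W), g 1 = g' 1 → g = g' := by
    intro g g' h
    ext r
    obtain ⟨r, rfl⟩ := residue_surjective r
    rw [hval, hval, h]
  obtain ⟨u, hu, hmu⟩ := exists_notMem_forall_smul_mem h0
    (Submodule.ne_top_of_fg_of_isFractionRing hS hfg)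
  have : Nontrivial (ResidueField S →ₗ[S] K ⧸ W) := by
    refine ⟨(maximalIdeal S).liftQ (LinearMap.toSpanSingleton S _ (W.mkQ u)) ?_, 0, fun h ↦ hu ?_⟩
    · intro r hr
      rw [LinearMap.mem_ker, LinearMap.toSpanSingleton_apply, ← map_smul]
      exact (Submodule.Quotient.mk_eq_zero W).mpr (hmu r hr)
    · have := LinearMap.congr_fun h (residue S 1)
      rw [← Submodule.Quotient.mk_eq_zero W]
      exact (one_smul S (W.mkQ u)).symm.trans this
  rw [isSimpleModule_iff_toSpanSingleton_surjective]
  refine ⟨this, fun g hg g' ↦ ?_⟩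
  obtain ⟨u, hu⟩ := W.mkQ_surjective (g 1)
  obtain ⟨v, hv⟩ := W.mkQ_surjective (g' 1)
  obtain ⟨s, hs⟩ := exists_sub_smul_mem hS hW hfg h0 (u := u) (v := v)
    (fun h ↦ hg (hext _ _ (by
      rw [← hu, LinearMap.zero_apply]; exact (Submodule.Quotient.mk_eq_zero W).mpr h)))
    (fun r hr ↦ by
      rw [← Submodule.Quotient.mk_eq_zero W, ← Submodule.mkQ_apply, map_smul, hv]
      exact hker g' r hr)
  refine ⟨s, hext _ _ ?_⟩
  rw [LinearMap.toSpanSingleton_apply, LinearMap.smul_apply, ← hu, ← hv, ← map_smul]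
  exact ((Submodule.Quotient.eq W).mpr hs).symm

/-- The connecting map Hom(κ, K/W) → Ext¹(κ, W) is bijective: Hom(κ, K) = 0 by torsion-freeness and
Ext¹(κ, K) = 0 by injectivity. The source is the simple socle of K/W. -/
theorem length_ext_one_residueField (hS : ¬ IsField S) (hW : Module.Baer S (K ⧸ W))
    (hfg : W.FG) (h0 : W ≠ ⊥) :
    Module.length S
      (Abelian.Ext (ModuleCat.of S (ResidueField S)) (ModuleCat.of S W) 1) = 1 := by
  have h2 : Injective (ModuleCat.of S K) := by
    rw [← Module.injective_iff_injective_object, ← Module.Baer.iff_injective]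
    exact baer_fractionRing S K
  have hT := shortExact_quotient W
  let F := hT.extClass.postcompOfLinear S (ModuleCat.of S (ResidueField S)) (zero_add 1)
  have hF : Function.Bijective F := by
    constructor
    · rw [injective_iff_map_eq_zero]
      intro e he
      obtain ⟨g, rfl⟩ := Abelian.Ext.covariant_sequence_exact₃ _ hT e (zero_add 1) he
      obtain ⟨g, rfl⟩ := Abelian.Ext.homEquiv₀.symm.surjective g
      have : g = 0 := by
        obtain ⟨r, hr, hr0⟩ := Submodule.exists_mem_ne_zero_of_ne_bot
          (isField_iff_maximalIdeal_eq.not.mp hS)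
        ext z
        have h1 : r • g.hom z = 0 := by
          rw [← map_smul]
          convert map_zero g.hom
          obtain ⟨z, rfl⟩ := residue_surjective z
          rw [Algebra.smul_def]
          change residue S r * _ = 0
          rw [(residue_eq_zero_iff r).mpr hr, zero_mul]
        change g.hom z = 0
        rw [Algebra.smul_def] at h1
        exact (mul_eq_zero.mp h1).resolve_left (by simpa using hr0)
      rw [this]
      change (Abelian.Ext.mk₀ _).comp _ _ = 0
      rw [Abelian.Ext.mk₀_zero, Abelian.Ext.zero_comp]
    · intro e
      exact Abelian.Ext.covariant_sequence_exact₁ _ hT e (Abelian.Ext.eq_zero_of_injective _)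
        (zero_add 1)
  have := isSimpleModule_residueField_hom hS hW hfg h0
  rw [← (LinearEquiv.ofBijective F hF).length_eq,
    (Abelian.Ext.linearEquiv₀ (R := S)).length_eq,
    (ModuleCat.homLinearEquiv (S := S)).length_eq]
  exact Module.length_eq_one S _

theorem isMaximalCohenMacaulay_of_isTorsionFree {S : Type u} [CommRing S] [IsDomain S]
    [IsLocalRing S] [IsNoetherianRing S] (hS : ringKrullDim S = 1) (M : Type u) [AddCommGroup M]
    [Module S M] [Module.IsTorsionFree S M] [Nontrivial M] [Module.Finite S M] :
    IsMaximalCohenMacaulay S M := by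
  obtain ⟨x, hxm, hx⟩ := Submodule.exists_mem_ne_zero_of_ne_bot
    (isField_iff_maximalIdeal_eq.not.mp (not_isField_of_ringKrullDim_eq_one hS))
  refine ⟨inferInstance, [x], by simpa using hxm, ?_, by simpa using hS⟩
  rw [IsLocalRing.isRegular_iff_isWeaklyRegular_of_subset_maximalIdeal (by simpa using hxm),
    RingTheory.Sequence.isWeaklyRegular_singleton_iff]
  exact smul_right_injective M hx

theorem isCanonicalModule_of_baer_quotient {S : Type u} [CommRing S] [IsDomain S]
    [IsLocalRing S] [IsNoetherianRing S] (hS : ringKrullDim S = 1) {K : Type u} [Field K]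
    [Algebra S K] [IsFractionRing S K] {W : Submodule S K} (hW : Module.Baer S (K ⧸ W))
    (hfg : W.FG) (h0 : W ≠ ⊥) : IsCanonicalModule S W := by
  have := dimensionLEOne_of_ringKrullDim_eq_one hS
  have hF := not_isField_of_ringKrullDim_eq_one hS
  have : Module.Finite S W := Module.Finite.iff_fg.mpr hfg
  have : Nontrivial W := Submodule.nontrivial_iff_ne_bot.mpr h0
  have : Module.IsTorsionFree S K := inferInstance
  have : Module.IsTorsionFree S W := inferInstance
  exact
    { isNoetherianRing := inferInstance
      isCohenMacaulay := isMaximalCohenMacaulay_of_isTorsionFree hS S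
      isMaximalCohenMacaulay := isMaximalCohenMacaulay_of_isTorsionFree hS W
      type_eq_one := ⟨1, by simpa using hS, length_ext_one_residueField hF hW hfg h0⟩
      finite_injectiveDimension := ⟨1, hasInjectiveDimensionLE_one_of_baer_quotient hW⟩ }

end

end Canonical

/-! ### Finiteness of the integral closure. -/

section Normalization

theorem isPrecomplete_pi {R : Type*} [CommRing R] (I : Ideal R) [IsPrecomplete I R]
    (ι : Type*) [Fintype ι] : IsPrecomplete I (ι → R) where
  prec' f hf := by
    classical
    have h1 : ∀ i, ∀ {m n}, m ≤ n → f m i ≡ f n i [SMOD (I ^ m • ⊤ : Submodule R R)] := by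
      intro i m n hmn
      have h := SModEq.sub_mem.mp (hf hmn)
      rw [SModEq.sub_mem]
      have := Submodule.mem_map_of_mem (f := LinearMap.proj (R := R) (φ := fun _ : ι ↦ R) i) h
      rw [Submodule.map_smul''] at this
      exact Submodule.smul_mono le_rfl le_top this
    choose L hL using fun i ↦ IsPrecomplete.prec inferInstance (h1 i)
    refine ⟨L, fun n ↦ ?_⟩
    rw [SModEq.sub_mem, pi_eq_sum_univ' (f n - L)]
    refine Submodule.sum_mem _ fun i _ ↦ Submodule.smul_mem_smul ?_ trivial
    simpa using SModEq.sub_mem.mp (hL i n)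

theorem exists_pow_mem_span_singleton {R : Type*} [CommRing R] [IsLocalRing R]
    [Ring.DimensionLEOne R] {x a : R} (hx : x ∈ maximalIdeal R) (ha : a ≠ 0) :
    ∃ n : ℕ, x ^ n ∈ Ideal.span {a} := by
  change x ∈ (Ideal.span {a}).radical
  rw [Ideal.radical_eq_sInf, Ideal.mem_sInf]
  rintro p ⟨hp, hpp⟩
  rw [eq_maximalIdeal_of_isPrime hpp]
  · exact hx
  · rintro rfl
    exact ha (by simpa using hp)

theorem isArtinianRing_quotient_span_singleton {R : Type*} [CommRing R] [IsLocalRing R]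
    [IsNoetherianRing R] [Ring.DimensionLEOne R] {x : R} (hx : x ≠ 0) :
    IsArtinianRing (R ⧸ Ideal.span {x}) := by
  rw [isArtinianRing_iff_krullDimLE_zero, Ring.krullDimLE_zero_iff]
  intro p hp
  have h : p.comap (Ideal.Quotient.mk (Ideal.span {x})) = maximalIdeal R := by
    refine eq_maximalIdeal_of_isPrime inferInstance fun h ↦ hx ?_
    rw [← Ideal.mem_bot, ← h, Ideal.mem_comap,
      Ideal.Quotient.eq_zero_iff_mem.mpr (Ideal.mem_span_singleton_self x)]
    exact p.zero_mem
  have : (p.comap (Ideal.Quotient.mk (Ideal.span {x}))).IsMaximal := h ▸ inferInstance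
  rw [← Ideal.map_comap_of_surjective _ Ideal.Quotient.mk_surjective p]
  exact Ideal.map_eq_top_or_isMaximal_of_surjective _ Ideal.Quotient.mk_surjective this |>.resolve_left
    (by rw [Ideal.map_comap_of_surjective _ Ideal.Quotient.mk_surjective p]; exact hp.ne_top)

theorem mem_maximalIdeal_of_isIdealReduction {R : Type*} [CommRing R] [IsLocalRing R] {x : R}
    (hx : IsIdealReduction (Ideal.span {x}) (maximalIdeal R)) : x ∈ maximalIdeal R :=
  hx.1 (Ideal.mem_span_singleton_self x)

variable {R : Type*} [CommRing R] [IsDomain R] [IsLocalRing R] {K : Type*} [Field K] [Algebra R K]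
  [IsFractionRing R K] {x : R}

theorem ne_zero_of_isIdealReduction (hR : ¬ IsField R)
    (hx : IsIdealReduction (Ideal.span {x}) (maximalIdeal R)) : x ≠ 0 := by
  rintro rfl
  obtain ⟨-, n, hn⟩ := hx
  refine isField_iff_maximalIdeal_eq.not.mp hR (pow_eq_zero_iff (n := n + 1) (by omega) |>.mp ?_)
  rw [← hn]
  simp

/-- Multiplication by r/x preserves mⁿ, since r mⁿ ⊆ mⁿ⁺¹ = x mⁿ; the determinant trick applies. -/
theorem div_mem_integralClosure_of_isIdealReduction [IsNoetherianRing R] (hR : ¬ IsField R)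
    (hx : IsIdealReduction (Ideal.span {x}) (maximalIdeal R)) {r : R} (hr : r ∈ maximalIdeal R) :
    algebraMap R K r / algebraMap R K x ∈ integralClosure R K := by
  have hx0 : algebraMap R K x ≠ 0 := by simpa using ne_zero_of_isIdealReduction hR hx
  obtain ⟨hle, n, hn⟩ := hx
  let N : Submodule R K := Submodule.map (Algebra.linearMap R K) (maximalIdeal R ^ n)
  have hxm := hle (Ideal.mem_span_singleton_self x)
  refine isIntegral_of_smul_mem_submodule N ?_ ((IsNoetherian.noetherian _).map _) _ ?_
  · refine fun h ↦ pow_ne_zero n hx0 ?_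
    have : algebraMap R K (x ^ n) ∈ N := ⟨_, Ideal.pow_mem_pow hxm n, rfl⟩
    rw [h] at this
    simpa using this
  · rintro _ ⟨a, ha, rfl⟩
    have h1 : r * a ∈ Ideal.span {x} * maximalIdeal R ^ n := by
      rw [hn, pow_succ']
      exact Ideal.mul_mem_mul hr ha
    obtain ⟨b, hb, hab⟩ := Ideal.mem_span_singleton_mul.mp h1
    refine ⟨b, hb, ?_⟩
    simp only [Algebra.linearMap_apply, smul_eq_mul]
    rw [div_mul_eq_mul_div, ← map_mul, ← hab, map_mul, mul_div_cancel_left₀ _ hx0]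

theorem div_pow_mem_integralClosure_of_isIdealReduction [IsNoetherianRing R] (hR : ¬ IsField R)
    (hx : IsIdealReduction (Ideal.span {x}) (maximalIdeal R)) {n : ℕ} {r : R}
    (hr : r ∈ maximalIdeal R ^ n) :
    algebraMap R K r / algebraMap R K x ^ n ∈ integralClosure R K := by
  induction n generalizing r with
  | zero => simp
  | succ n ih =>
    rw [pow_succ] at hr
    refine Submodule.mul_induction_on hr (fun a ha b hb ↦ ?_) fun a b ha hb ↦ ?_
    · rw [map_mul, pow_succ, mul_div_mul_comm]
      exact mul_mem (ih ha) (div_mem_integralClosure_of_isIdealReduction hR hx hb)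
    · rw [map_add, add_div]
      exact add_mem ha hb

theorem inv_notMem_integralClosure (hx : x ∈ maximalIdeal R) (hx0 : x ≠ 0) :
    (algebraMap R K x)⁻¹ ∉ integralClosure R K := by
  intro h
  have hx0' : algebraMap R K x ≠ 0 := by simpa using hx0
  have hu : IsUnit (algebraMap R (integralClosure R K) x) := by
    refine IsUnit.of_mul_eq_one ⟨_, h⟩ ?_
    ext
    exact mul_inv_cancel₀ hx0'
  have : FaithfulSMul R (integralClosure R K) := inferInstance
  exact (mem_maximalIdeal x).mp hx (isUnit_of_map_unit (algebraMap R (integralClosure R K)) x hu)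

variable [IsNoetherianRing R] [Ring.DimensionLEOne R]

/-- An element z of every mⁿR̄ has all z/xⁿ integral. If z = a/b ≠ 0 and xⁿ = ra, then rb · z/xⁿ⁺¹ =
1/x would be integral. -/
theorem isHausdorff_integralClosure (hR : ¬ IsField R)
    (hx : IsIdealReduction (Ideal.span {x}) (maximalIdeal R)) :
    IsHausdorff (maximalIdeal R) (integralClosure R K) where
  haus' z hz := by
    have hx1 := ne_zero_of_isIdealReduction hR hx
    have hxm := mem_maximalIdeal_of_isIdealReduction hx
    have hx0 : algebraMap R K x ≠ 0 := by simpa using hx1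
    have h1 : ∀ n : ℕ, (z : K) / algebraMap R K x ^ n ∈ integralClosure R K := by
      intro n
      have h := hz n
      rw [SModEq.zero] at h
      refine Submodule.smul_induction_on h (fun r hr w _ ↦ ?_) fun a b ha hb ↦ ?_
      · rw [SetLike.val_smul, Algebra.smul_def, mul_div_right_comm]
        exact mul_mem (div_pow_mem_integralClosure_of_isIdealReduction hR hx hr) w.2
      · rw [Subalgebra.coe_add, add_div]
        exact add_mem ha hb
    by_contra hz0
    obtain ⟨a, b, hb, hab⟩ := IsFractionRing.div_surjective (A := R) (z : K)
    have hb0 : algebraMap R K b ≠ 0 :=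
      IsLocalization.to_map_ne_zero_of_mem_nonZeroDivisors K le_rfl hb
    have ha0 : a ≠ 0 := by
      rintro rfl
      apply hz0
      ext
      simp [← hab]
    obtain ⟨n, hn⟩ := exists_pow_mem_span_singleton hxm ha0
    obtain ⟨r, hr⟩ := Ideal.mem_span_singleton'.mp hn
    refine inv_notMem_integralClosure (K := K) hxm hx1 ?_
    have h2 := mul_mem ((integralClosure R K).algebraMap_mem (r * b)) (h1 (n + 1))
    convert h2 using 1
    have h3 : algebraMap R K r * algebraMap R K a = algebraMap R K x ^ n := by
      rw [← map_mul, hr, map_pow]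
    rw [← hab, map_mul, pow_succ, ← h3]
    have ha0' : algebraMap R K a ≠ 0 := by simpa using ha0
    have hr0' : algebraMap R K r ≠ 0 := by
      intro h
      rw [h, zero_mul] at h3
      exact pow_ne_zero n hx0 h3.symm
    field_simp

/-- The Krull-Akizuki argument: modulo `x`, the integral closure is generated by elements with
bounded denominators. -/
theorem exists_pow_mul_eq_add {R : Type*} [CommRing R] [IsLocalRing R] [IsNoetherianRing R]
    [Ring.DimensionLEOne R] {K : Type*} [Field K] [Algebra R K] [IsFractionRing R K] {x : R}
    (hxm : x ∈ maximalIdeal R) (hx1 : x ≠ 0) :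
    ∃ n : ℕ, ∀ y ∈ integralClosure R K, ∃ y' ∈ integralClosure R K, ∃ r : R,
      algebraMap R K x ^ n * y = algebraMap R K x ^ (n + 1) * y' + algebraMap R K r := by
  have hx0 : algebraMap R K x ≠ 0 := by simpa using hx1
  -- `I m` is (xᵐR̄ ∩ R) + xR. This descending chain contains x, so it stabilizes because R/(x) is
  -- Artinian.
  let I : ℕ → Ideal R := fun m ↦ ((Subalgebra.toSubmodule (integralClosure R K)).comap
    (LinearMap.toSpanSingleton R K ((algebraMap R K x ^ m)⁻¹))) ⊔ Ideal.span {x}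
  have hI : ∀ m r, r ∈ I m ↔ ∃ y ∈ integralClosure R K, ∃ s : R,
      algebraMap R K r = algebraMap R K x ^ m * y + algebraMap R K (x * s) := by
    intro m r
    constructor
    · intro hr
      obtain ⟨a, ha, b, hb, rfl⟩ := Submodule.mem_sup.mp hr
      obtain ⟨s, rfl⟩ := Ideal.mem_span_singleton'.mp hb
      refine ⟨_, ha, s, ?_⟩
      rw [LinearMap.toSpanSingleton_apply, Algebra.smul_def, map_add, mul_comm s x]
      field_simp
    · rintro ⟨y, hy, s, hr⟩
      have h : r = (r - x * s) + x * s := by ring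
      rw [h]
      refine Submodule.add_mem_sup ?_ (Ideal.mem_span_singleton'.mpr ⟨s, mul_comm _ _⟩)
      change (r - x * s) • (algebraMap R K x ^ m)⁻¹ ∈ integralClosure R K
      rw [Algebra.smul_def, map_sub, hr]
      convert hy using 1
      field_simp
      ring
  have hanti : Antitone I := antitone_nat_of_succ_le fun m r hr ↦ by
    rw [hI] at hr ⊢
    obtain ⟨y, hy, s, hr⟩ := hr
    refine ⟨algebraMap R K x * y, mul_mem (algebraMap_mem _ x) hy, s, ?_⟩
    rw [hr]
    ring
  have := isArtinianRing_quotient_span_singleton hx1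
  obtain ⟨n, hn⟩ := IsArtinian.monotone_stabilizes (R := R ⧸ Ideal.span {x})
    (M := R ⧸ Ideal.span {x})
    ⟨fun m ↦ OrderDual.toDual ((I m).map (Ideal.Quotient.mk (Ideal.span {x}))),
      fun a b hab ↦ Ideal.map_mono (hanti hab)⟩
  have hstab : ∀ m, n ≤ m → I m ≤ I (m + 1) := by
    intro m hm
    have h1 := (hn m hm).symm.trans (hn (m + 1) (by omega))
    have h2 : (I m).map (Ideal.Quotient.mk (Ideal.span {x})) =
      (I (m + 1)).map (Ideal.Quotient.mk (Ideal.span {x})) := h1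
    have h3 : ∀ j, ((I j).map (Ideal.Quotient.mk (Ideal.span {x}))).comap
        (Ideal.Quotient.mk (Ideal.span {x})) = I j := fun j ↦ by
      rw [Ideal.comap_map_of_surjective _ Ideal.Quotient.mk_surjective, ← RingHom.ker_eq_comap_bot,
        Ideal.mk_ker]
      exact sup_eq_left.mpr le_sup_right
    rw [← h3 m, h2, h3]
  refine ⟨n, fun y hy ↦ ?_⟩
  -- For large `j` the power of x clears the denominator of y. Stability of the chain then lets one
  -- factor x be cancelled at a time, down to exponent `n`.
  obtain ⟨j, hj⟩ : ∃ j : ℕ, ∃ y' ∈ integralClosure R K, ∃ r : R,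
      algebraMap R K x ^ (n + j) * y = algebraMap R K x ^ (n + j + 1) * y' + algebraMap R K r := by
    obtain ⟨a, b, hb, hab⟩ := IsFractionRing.div_surjective (A := R) y
    have hb0 : algebraMap R K b ≠ 0 :=
      IsLocalization.to_map_ne_zero_of_mem_nonZeroDivisors K le_rfl hb
    obtain ⟨j, hj⟩ := exists_pow_mem_span_singleton hxm (nonZeroDivisors.ne_zero hb)
    obtain ⟨s, hs⟩ := Ideal.mem_span_singleton'.mp hj
    refine ⟨j, 0, zero_mem _, x ^ n * s * a, ?_⟩
    rw [pow_add, ← map_pow, ← map_pow, ← hs, ← hab]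
    simp only [map_mul, map_pow]
    field_simp
    ring
  induction j with
  | zero => exact hj
  | succ j ih =>
    apply ih
    obtain ⟨y', hy', r, h⟩ := hj
    have hr : r ∈ I (n + (j + 1)) := by
      rw [hI]
      refine ⟨y - algebraMap R K x * y', sub_mem hy (mul_mem (algebraMap_mem _ x) hy'), 0, ?_⟩
      rw [mul_zero, map_zero]
      linear_combination -h
    obtain ⟨y'', hy'', s, hs⟩ := (hI _ _).mp (hstab _ (by omega) hr)
    refine ⟨y' + y'', add_mem hy' hy'', s, ?_⟩
    apply mul_left_cancel₀ hx0
    rw [hs, map_mul] at h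
    linear_combination h

/-- The integral closure of a complete one-dimensional Noetherian local domain is finite. -/
theorem finite_integralClosure [IsAdicComplete (maximalIdeal R) R] (hR : ¬ IsField R)
    (hx : IsIdealReduction (Ideal.span {x}) (maximalIdeal R)) :
    Module.Finite R (integralClosure R K) := by
  have hx1 := ne_zero_of_isIdealReduction hR hx
  have hxm := mem_maximalIdeal_of_isIdealReduction hx
  have hx0 : algebraMap R K x ≠ 0 := by simpa using hx1
  obtain ⟨n, hn⟩ := exists_pow_mul_eq_add (K := K) hxm hx1
  let B := integralClosure R K
  -- `F` consists of the y with xⁿy ∈ R, so it is isomorphic to an ideal and finitely generated. The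
  -- preceding bound says R̄ = F + xR̄; completeness of R and separatedness of R̄ upgrade generation
  -- modulo m to generation.
  let F : Submodule R B := (1 : Submodule R K).comap
    (LinearMap.mulLeft R (algebraMap R K x ^ n) ∘ₗ B.val.toLinearMap)
  have hF : F.FG := by
    have : IsNoetherian R (1 : Submodule R K) := isNoetherian_of_fg_of_noetherian _
      (Submodule.one_eq_span (R := R) (A := K) ▸ Submodule.fg_span_singleton _)
    have : IsNoetherian R F := isNoetherian_of_injective
      ((LinearMap.mulLeft R (algebraMap R K x ^ n) ∘ₗ B.val.toLinearMap).restrict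
        (p := F) (q := 1) fun z hz ↦ hz) fun a b hab ↦ by
        have h := congrArg Subtype.val hab
        exact Subtype.ext (Subtype.ext (mul_left_cancel₀ (pow_ne_zero n hx0) h))
    exact (Submodule.fg_top F).mp (IsNoetherian.noetherian _)
  have := isHausdorff_integralClosure (K := K) hR hx
  have : Module.Finite R F := Module.Finite.iff_fg.mpr hF
  obtain ⟨k, g', hg'⟩ := Module.Finite.exists_fin' R F
  let g : (Fin k → R) →ₗ[R] B := F.subtype ∘ₗ g'
  have hg : LinearMap.range g = F := by
    rw [LinearMap.range_comp, LinearMap.range_eq_top.mpr hg', Submodule.map_top,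
      Submodule.range_subtype]
  have := isPrecomplete_pi (maximalIdeal R) (Fin k)
  refine Module.Finite.of_surjective g (surjective_of_mkQ_comp_surjective (I := maximalIdeal R) ?_)
  intro q
  obtain ⟨y, rfl⟩ := Submodule.mkQ_surjective _ q
  obtain ⟨y', hy', r, h⟩ := hn y y.2
  have hmem : y - x • (⟨y', hy'⟩ : B) ∈ LinearMap.range g := by
    rw [hg]
    change algebraMap R K x ^ n * (y - x • y') ∈ (1 : Submodule R K)
    rw [Submodule.mem_one]
    refine ⟨r, ?_⟩
    rw [Algebra.smul_def]
    linear_combination -h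
  obtain ⟨v, hv⟩ := hmem
  refine ⟨v, ?_⟩
  rw [LinearMap.comp_apply, hv, Submodule.mkQ_apply, Submodule.mkQ_apply, Submodule.Quotient.eq]
  rw [sub_sub_cancel_left]
  exact neg_mem (Submodule.smul_mem_smul hxm trivial)

end Normalization

/-! ### Integral closure of mω via extension to R̄. -/

section IdealClosure

/-- Cayley–Hamilton for multiplication by r, which maps B into IB. -/
theorem isIntegralOverIdeal_of_smul_mem {R : Type*} [CommRing R] {B : Type*} [CommRing B]
    [Nontrivial B] [Algebra R B] [FaithfulSMul R B] [Module.Finite R B] {I : Ideal R} {r : R}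
    (h : algebraMap R B r ∈ I • (⊤ : Submodule R B)) : IsIntegralOverIdeal I r := by
  have hrange : LinearMap.range (algebraMap R (Module.End R B) r) ≤ I • ⊤ := by
    rintro _ ⟨b, rfl⟩
    have := Submodule.mem_map_of_mem (f := LinearMap.mulLeft R b) h
    rw [Submodule.map_smul''] at this
    convert Submodule.smul_mono le_rfl le_top this using 1
    simp [Algebra.smul_def, mul_comm]
  obtain ⟨p, hp, -, hcoeff, h0⟩ :=
    LinearMap.exists_monic_and_natDegree_eq_and_coeff_mem_pow_and_aeval_eq_zero R _ I hrange
  have heval : p.eval r = 0 := by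
    rw [aeval_algebraMap_apply] at h0
    have h1 := LinearMap.congr_fun h0 1
    rw [Module.algebraMap_end_apply, LinearMap.zero_apply, Algebra.smul_def, mul_one] at h1
    exact (FaithfulSMul.algebraMap_injective R B) (by rw [map_zero, ← h1]; simp)
  have : Nontrivial R := (algebraMap R B).domain_nontrivial
  have hn : 0 < p.natDegree := by
    rcases Nat.eq_zero_or_pos p.natDegree with h0 | h0
    · rw [eq_one_of_monic_natDegree_zero hp h0, eval_one] at heval
      exact absurd heval one_ne_zero
    · exact h0
  -- Beyond the degree, truncated subtraction would return the constant coefficient, which need not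
  -- lie in `I ^ i`; hence the default 0.
  refine ⟨p.natDegree, hn, fun i ↦ if i ≤ p.natDegree then p.coeff (p.natDegree - i) else 0,
    fun i ↦ ?_, ?_⟩
  · dsimp only
    split_ifs with hi
    · simpa [Nat.sub_sub_self hi] using hcoeff (p.natDegree - i)
    · exact zero_mem _
  · rw [eval_eq_sum_range, Finset.sum_range_succ, hp.coeff_natDegree, one_mul] at heval
    rw [add_comm]
    refine Eq.trans ?_ heval
    congr 1
    refine Finset.sum_bij' (fun i _ ↦ p.natDegree - i) (fun j _ ↦ p.natDegree - j) ?_ ?_ ?_ ?_ ?_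
    · intro i hi
      rw [Finset.mem_Icc] at hi
      rw [Finset.mem_range]
      omega
    · intro j hj
      rw [Finset.mem_range] at hj
      rw [Finset.mem_Icc]
      omega
    · intro i hi
      rw [Finset.mem_Icc] at hi
      omega
    · intro j hj
      rw [Finset.mem_range] at hj
      omega
    · intro i hi
      rw [Finset.mem_Icc] at hi
      dsimp only
      rw [if_pos hi.2]

/-- Evaluation at 1/w sends the Rees algebra into R̄ and the degree-one monomial of r to r/w. -/
theorem IsIntegralOverIdeal.div_mem_integralClosure {R : Type u} [CommRing R] {K : Type*} [Field K]
    [Algebra R K] {I : Ideal R} {w : K}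
    (hI : ∀ a ∈ I, algebraMap R K a / w ∈ integralClosure R K) {r : R}
    (hr : IsIntegralOverIdeal I r) : algebraMap R K r / w ∈ integralClosure R K := by
  have hpow : ∀ (n : ℕ), ∀ a ∈ I ^ n, algebraMap R K a / w ^ n ∈ integralClosure R K := by
    intro n
    induction n with
    | zero => simp
    | succ n ih =>
      intro a ha
      rw [pow_succ] at ha
      refine Submodule.mul_induction_on ha (fun a ha b hb ↦ ?_) fun a b ha hb ↦ ?_
      · rw [map_mul, pow_succ, mul_div_mul_comm]
        exact mul_mem (ih a ha) (hI b hb)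
      · rw [map_add, add_div]
        exact add_mem ha hb
  rw [isIntegralOverIdeal_iff_rees] at hr
  let ψ : R[X] →+* K := eval₂RingHom (algebraMap R K) w⁻¹
  have hψ : ∀ p : reesAlgebra I, ψ p ∈ (integralClosure R K).toSubring := by
    intro p
    change eval₂ _ _ _ ∈ _
    rw [eval₂_eq_sum_range]
    refine sum_mem fun i _ ↦ ?_
    rw [inv_pow, ← div_eq_mul_inv]
    exact hpow i _ (p.2 i)
  let φ : reesAlgebra I →+* integralClosure R K :=
    (ψ.comp (algebraMap (reesAlgebra I) R[X])).codRestrict (integralClosure R K).toSubring hψ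
  have h := hr.map_of_comp_eq φ ψ rfl
  have h2 : ψ (monomial 1 r) = algebraMap R K r / w := by
    change eval₂ _ _ _ = _
    rw [eval₂_monomial, pow_one, div_eq_mul_inv]
  rw [h2] at h
  exact isIntegral_trans _ h

variable {R : Type u} [CommRing R] [IsDomain R] [IsLocalRing R] [IsNoetherianRing R]
  [Ring.DimensionLEOne R] {K : Type u} [Field K] [Algebra R K] [IsFractionRing R K]

/-- A Dedekind domain with finitely many maximal ideals is principal; here all of them lie over m.
-/
theorem isPrincipalIdealRing_integralClosure [Module.Finite R (integralClosure R K)] :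
    IsPrincipalIdealRing (integralClosure R K) := by
  have : IsNoetherianRing (integralClosure R K) := IsNoetherianRing.of_finite R _
  have : IsIntegrallyClosed (integralClosure R K) := by
    rw [isIntegrallyClosed_iff K]
    intro z hz
    exact ⟨⟨z, isIntegral_trans _ hz⟩, rfl⟩
  have : IsDedekindDomain (integralClosure R K) := {}
  refine IsPrincipalIdealRing.of_finite_maximals
    ((IsDedekindDomain.primesOver_finite (maximalIdeal R) (integralClosure R K)).subset ?_)
  intro M hM
  have hM' : M.IsMaximal := hM
  refine ⟨hM'.isPrime, ⟨(eq_maximalIdeal ?_).symm⟩⟩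
  exact Ideal.isMaximal_comap_of_isIntegral_of_isMaximal M

/-- The extension of an ideal of `R` to the integral closure is principal. -/
theorem exists_mem_mul_integralClosure_iff [Module.Finite R (integralClosure R K)]
    (ω : Ideal R) :
    ∃ w : K, ∀ z : K, z ∈ Submodule.map (Algebra.linearMap R K) ω *
      Subalgebra.toSubmodule (integralClosure R K) ↔ ∃ b ∈ integralClosure R K, z = w * b := by
  have := isPrincipalIdealRing_integralClosure (R := R) (K := K)
  let B := integralClosure R K
  obtain ⟨β, hβ⟩ := (IsPrincipalIdealRing.principal (ω.map (algebraMap R B))).principal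
  refine ⟨β, fun z ↦ ⟨fun hz ↦ ?_, ?_⟩⟩
  · refine Submodule.mul_induction_on hz ?_ ?_
    · rintro _ ⟨a, ha, rfl⟩ b hb
      have h1 : algebraMap R B a ∈ ω.map (algebraMap R B) := Ideal.mem_map_of_mem _ ha
      rw [hβ] at h1
      obtain ⟨c, hc⟩ := Submodule.mem_span_singleton.mp h1
      refine ⟨c * b, mul_mem c.2 hb, ?_⟩
      have := congrArg Subtype.val hc
      rw [smul_eq_mul, MulMemClass.coe_mul] at this
      change algebraMap R K a * b = _
      change (c : K) * β = algebraMap R K a at this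
      rw [← this]
      ring
    · rintro a b ⟨c, hc, rfl⟩ ⟨d, hd, rfl⟩
      exact ⟨c + d, add_mem hc hd, by ring⟩
  · rintro ⟨b, hb, rfl⟩
    have h1 : β ∈ ω.map (algebraMap R B) := by rw [hβ]; exact Submodule.mem_span_singleton_self β
    have h2 : ∀ γ ∈ ω.map (algebraMap R B), (γ : K) ∈ Submodule.map (Algebra.linearMap R K) ω *
        Subalgebra.toSubmodule B := by
      intro γ hγ
      refine Submodule.span_induction ?_ ?_ ?_ ?_ hγ
      · rintro _ ⟨a, ha, rfl⟩
        have := Submodule.mul_mem_mul (M := Submodule.map (Algebra.linearMap R K) ω)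
          (N := Subalgebra.toSubmodule B) ⟨a, ha, rfl⟩ B.one_mem
        rwa [mul_one] at this
      · exact zero_mem _
      · exact fun _ _ _ _ h h' ↦ add_mem h h'
      · intro c d _ hd
        rw [smul_eq_mul, mul_comm c d, MulMemClass.coe_mul]
        have := Submodule.mul_mem_mul (N := Subalgebra.toSubmodule B) hd c.2
        rwa [mul_assoc, Subalgebra.isIdempotentElem_toSubmodule B |>.eq] at this
    have := Submodule.mul_mem_mul (N := Subalgebra.toSubmodule B) (h2 β h1) hb
    rwa [mul_assoc, Subalgebra.isIdempotentElem_toSubmodule B |>.eq] at this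

/-- With ωR̄ = wR̄, elements of mω become integral after division by xw, hence so does r. Conversely
xωR̄ ⊆ (mω)R̄, and Cayley–Hamilton applies. -/
theorem mem_idealIntegralClosure_maximalIdeal_mul_iff [Module.Finite R (integralClosure R K)]
    (hR : ¬ IsField R) {x : R} (hx : IsIdealReduction (Ideal.span {x}) (maximalIdeal R))
    {ω : Ideal R} (hω : ω ≠ ⊥) (r : R) :
    r ∈ idealIntegralClosure (maximalIdeal R * ω) ↔
      algebraMap R K r / algebraMap R K x ∈ Submodule.map (Algebra.linearMap R K) ω *
        Subalgebra.toSubmodule (integralClosure R K) := by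
  let B := integralClosure R K
  have hx0 : algebraMap R K x ≠ 0 := by simpa using ne_zero_of_isIdealReduction hR hx
  have hxm := mem_maximalIdeal_of_isIdealReduction hx
  constructor
  · intro hr
    obtain ⟨w, hw⟩ := exists_mem_mul_integralClosure_iff (K := K) ω
    have hω' : ∀ a ∈ ω, ∃ b ∈ B, algebraMap R K a = w * b := by
      intro a ha
      rw [← hw]
      have := Submodule.mul_mem_mul (M := Submodule.map (Algebra.linearMap R K) ω)
          (N := Subalgebra.toSubmodule B) ⟨a, ha, rfl⟩ B.one_mem
      rwa [mul_one] at this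
    have hw0 : w ≠ 0 := by
      rintro rfl
      obtain ⟨a, ha, ha0⟩ := Submodule.exists_mem_ne_zero_of_ne_bot hω
      obtain ⟨b, -, hab⟩ := hω' a ha
      rw [zero_mul] at hab
      exact ha0 (by simpa using hab)
    have := IsIntegralOverIdeal.div_mem_integralClosure (K := K) (w := algebraMap R K x * w) ?_ hr
    · rw [hw]
      refine ⟨_, this, ?_⟩
      field_simp
    · intro a ha
      refine Submodule.mul_induction_on ha (fun a ha b hb ↦ ?_) fun a b ha hb ↦ ?_
      · obtain ⟨c, hc, hbc⟩ := hω' b hb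
        rw [map_mul, mul_div_mul_comm, hbc, mul_div_cancel_left₀ _ hw0]
        exact mul_mem (div_mem_integralClosure_of_isIdealReduction hR hx ha) hc
      · rw [map_add, add_div]
        exact add_mem ha hb
  · intro hr
    refine isIntegralOverIdeal_of_smul_mem (B := B) ?_
    have key : ∀ z ∈ Submodule.map (Algebra.linearMap R K) ω * Subalgebra.toSubmodule B,
        ∃ β ∈ (maximalIdeal R * ω) • (⊤ : Submodule R B), (β : K) = algebraMap R K x * z := by
      intro z hz
      refine Submodule.mul_induction_on hz ?_ ?_
      · rintro _ ⟨a, ha, rfl⟩ b hb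
        refine ⟨(x * a) • (⟨b, hb⟩ : B), Submodule.smul_mem_smul (Ideal.mul_mem_mul hxm ha) trivial,
          ?_⟩
        rw [SetLike.val_smul, Algebra.smul_def, map_mul, mul_assoc]
        rfl
      · rintro a b ⟨c, hc, hc'⟩ ⟨d, hd, hd'⟩
        exact ⟨c + d, add_mem hc hd, by rw [Subalgebra.coe_add, hc', hd']; ring⟩
    obtain ⟨β, hβ, hβr⟩ := key _ hr
    convert hβ
    ext
    rw [hβr, mul_div_cancel₀ _ hx0]
    rfl

end IdealClosure

/-! ### The ring S = R[C/x] and its dual Ω : S. -/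

section Transform

variable {R : Type u} [CommRing R] {K : Type u} [Field K] [Algebra R K]

theorem mem_conductorIdeal_iff {c : R} : c ∈ conductorIdeal R K ↔
    ∀ b ∈ integralClosure R K, ∃ r : R, algebraMap R K r = algebraMap R K c * b := by
  change algebraMap R K c ∈ (1 : Submodule R K) / _ ↔ _
  rw [Submodule.mem_div_iff_forall_mul_mem]
  simp only [Submodule.mem_one]
  rfl

theorem exists_mem_conductorIdeal_eq_mul {c : R} (hc : c ∈ conductorIdeal R K) {b : K}
    (hb : b ∈ integralClosure R K) :
    ∃ c' ∈ conductorIdeal R K, algebraMap R K c' = algebraMap R K c * b := by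
  obtain ⟨r, hr⟩ := mem_conductorIdeal_iff.mp hc b hb
  refine ⟨r, mem_conductorIdeal_iff.mpr fun b' hb' ↦ ?_, hr⟩
  rw [hr, mul_assoc]
  exact mem_conductorIdeal_iff.mp hc _ (mul_mem hb hb')

theorem ringKrullDim_subalgebra_eq_one {R : Type*} [CommRing R] [IsDomain R]
    [Ring.DimensionLEOne R] {K : Type*} [Field K] [Algebra R K] [IsFractionRing R K]
    (hR : ¬ IsField R) (S : Subalgebra R K)
    [Module.Finite R S] : ringKrullDim S = 1 := by
  have : Ring.DimensionLEOne S := Ring.DimensionLEOne.of_isIntegral R S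
  refine ringKrullDim_eq_one_of_dimensionLEOne fun h ↦ hR ?_
  exact isField_of_isIntegral_of_isField (FaithfulSMul.algebraMap_injective R S) h

variable [IsDomain R] [IsLocalRing R] [IsNoetherianRing R] [IsFractionRing R K] {x : R}

/-- R + C/x is already closed under products: c'/x is integral and C is an ideal of R̄, so c(c'/x) ∈
C. -/
theorem mem_conductorTransform_iff (hR : ¬ IsField R)
    (hx : IsIdealReduction (Ideal.span {x}) (maximalIdeal R))
    (hC : conductorIdeal R K ≤ maximalIdeal R) {z : K} :
    z ∈ conductorTransform R K x ↔ ∃ r : R, ∃ c ∈ conductorIdeal R K,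
      z = algebraMap R K r + algebraMap R K c / algebraMap R K x := by
  constructor
  · intro hz
    refine Algebra.adjoin_induction ?_ ?_ ?_ ?_ hz
    · rintro _ ⟨c, hc, rfl⟩
      exact ⟨0, c, hc, by simp⟩
    · exact fun r ↦ ⟨r, 0, zero_mem _, by simp⟩
    · rintro _ _ _ _ ⟨r, c, hc, rfl⟩ ⟨r', c', hc', rfl⟩
      exact ⟨r + r', c + c', add_mem hc hc', by simp only [map_add]; ring⟩
    · rintro _ _ _ _ ⟨r, c, hc, rfl⟩ ⟨r', c', hc', rfl⟩
      obtain ⟨d, hd, hdc⟩ := exists_mem_conductorIdeal_eq_mul hc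
        (div_mem_integralClosure_of_isIdealReduction hR hx (hC hc'))
      refine ⟨r * r', r * c' + r' * c + d,
        add_mem (add_mem (Ideal.mul_mem_left _ _ hc') (Ideal.mul_mem_left _ _ hc)) hd, ?_⟩
      simp only [map_add, map_mul, hdc]
      ring
  · rintro ⟨r, c, hc, rfl⟩
    exact add_mem (Subalgebra.algebraMap_mem _ r) (Algebra.subset_adjoin ⟨c, hc, rfl⟩)

theorem conductorTransform_le_integralClosure (hR : ¬ IsField R)
    (hx : IsIdealReduction (Ideal.span {x}) (maximalIdeal R))
    (hC : conductorIdeal R K ≤ maximalIdeal R) :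
    conductorTransform R K x ≤ integralClosure R K := by
  refine Algebra.adjoin_le ?_
  rintro _ ⟨c, hc, rfl⟩
  exact div_mem_integralClosure_of_isIdealReduction hR hx (hC hc)

theorem finite_conductorTransform [Module.Finite R (integralClosure R K)] (hR : ¬ IsField R)
    (hx : IsIdealReduction (Ideal.span {x}) (maximalIdeal R))
    (hC : conductorIdeal R K ≤ maximalIdeal R) :
    Module.Finite R (conductorTransform R K x) :=
  Module.Finite.of_injective
    (Subalgebra.inclusion (conductorTransform_le_integralClosure hR hx hC)).toLinearMap
    (Subalgebra.inclusion_injective (conductorTransform_le_integralClosure hR hx hC))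

/-- As C ⊆ m², c/x² is integral and (c/x)² = c(c/x²) ∈ C ⊆ m. So c/x lies in every maximal ideal of
S, and adding it to a unit of R leaves a unit. -/
theorem isUnit_of_mem_conductorTransform [Module.Finite R (conductorTransform R K x)]
    (hR : ¬ IsField R) (hx : IsIdealReduction (Ideal.span {x}) (maximalIdeal R))
    (hC : conductorIdeal R K ≤ maximalIdeal R ^ 2) {r c : R} (hr : IsUnit r)
    (hc : c ∈ conductorIdeal R K) {s : conductorTransform R K x}
    (hs : (s : K) = algebraMap R K r + algebraMap R K c / algebraMap R K x) : IsUnit s := by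
  have hx0 : algebraMap R K x ≠ 0 := by simpa using ne_zero_of_isIdealReduction hR hx
  by_contra h
  obtain ⟨M, hM, hsM⟩ := exists_max_ideal_of_mem_nonunits h
  have hcomap : M.comap (algebraMap R (conductorTransform R K x)) = maximalIdeal R :=
    eq_maximalIdeal (Ideal.isMaximal_comap_of_isIntegral_of_isMaximal M)
  let q : conductorTransform R K x :=
    ⟨algebraMap R K c / algebraMap R K x, Algebra.subset_adjoin ⟨c, hc, rfl⟩⟩
  obtain ⟨d, hd, hdc⟩ := exists_mem_conductorIdeal_eq_mul hc
    (div_pow_mem_integralClosure_of_isIdealReduction (K := K) hR hx (hC hc))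
  have hq : q ^ 2 ∈ M := by
    have h1 : q ^ 2 = algebraMap R (conductorTransform R K x) d := by
      ext
      change (algebraMap R K c / algebraMap R K x) ^ 2 = algebraMap R K d
      rw [hdc]
      ring
    rw [h1, ← Ideal.mem_comap, hcomap]
    exact Ideal.pow_le_self two_ne_zero (hC hd)
  have hqM : q ∈ M := hM.isPrime.mem_of_pow_mem _ hq
  have hsq : s - q = algebraMap R (conductorTransform R K x) r := by
    ext
    change (s : K) - algebraMap R K c / algebraMap R K x = algebraMap R K r
    rw [hs]
    ring
  have hrM := sub_mem hsM hqM
  rw [hsq, ← Ideal.mem_comap, hcomap] at hrM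
  exact hrM hr

theorem isLocalRing_conductorTransform [Module.Finite R (conductorTransform R K x)]
    (hR : ¬ IsField R) (hx : IsIdealReduction (Ideal.span {x}) (maximalIdeal R))
    (hC : conductorIdeal R K ≤ maximalIdeal R ^ 2) :
    IsLocalRing (conductorTransform R K x) := by
  refine IsLocalRing.of_isUnit_or_isUnit_one_sub_self fun s ↦ ?_
  obtain ⟨r, c, hc, hs⟩ := (mem_conductorTransform_iff hR hx
    (hC.trans (Ideal.pow_le_self two_ne_zero))).mp s.2
  rcases IsLocalRing.isUnit_or_isUnit_one_sub_self r with h | h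
  · exact Or.inl (isUnit_of_mem_conductorTransform hR hx hC h hc hs)
  · refine Or.inr (isUnit_of_mem_conductorTransform hR hx hC h (neg_mem hc) ?_)
    change (1 : K) - s = _
    rw [hs, map_sub, map_one, map_neg]
    ring

theorem isFractionRing_subalgebra {R : Type*} [CommRing R] {K : Type*} [Field K] [Algebra R K]
    [IsFractionRing R K] (S : Subalgebra R K) : IsFractionRing S K := by
  refine IsFractionRing.of_field S K fun z ↦ ?_
  obtain ⟨a, b, -, hab⟩ := IsFractionRing.div_surjective (A := R) z
  exact ⟨algebraMap R S a, algebraMap R S b, hab.symm⟩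

variable [Ring.DimensionLEOne R]

variable {Ω : Submodule R K}

theorem Submodule.div_one_eq {R A : Type*} [CommSemiring R] [CommSemiring A] [Algebra R A]
    (Ω : Submodule R A) : Ω / 1 = Ω := by
  ext z
  rw [Submodule.mem_div_iff_forall_mul_mem]
  constructor
  · intro h
    simpa using h 1 (Submodule.one_le.mp le_rfl)
  · rintro h y hy
    obtain ⟨r, rfl⟩ := Submodule.mem_one.mp hy
    rw [mul_comm, ← Algebra.smul_def]
    exact Ω.smul_mem r h

/-- From Ω : Ω = R one gets Ω : ΩR̄ = R : R̄ = C; then dualize once more. -/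
theorem div_map_conductorIdeal (hR : ¬ IsField R) [Module.Finite R (integralClosure R K)]
    (hΩ : Module.Baer R (K ⧸ Ω)) (hΩ0 : Ω ≠ ⊥) (hfg : Ω.FG) :
    Ω / Submodule.map (Algebra.linearMap R K) (conductorIdeal R K) =
      Ω * Subalgebra.toSubmodule (integralClosure R K) := by
  have hΩ1 : Ω ≠ ⊤ := Submodule.ne_top_of_fg_of_isFractionRing hR hfg
  have h1 : Ω / Ω = 1 := by
    have h := div_div_eq_self hΩ hΩ0 hΩ1 (I := 1)
      (Submodule.one_eq_span (R := R) (A := K) ▸ Submodule.fg_span_singleton _)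
    rwa [Submodule.div_one_eq] at h
  have h2 : Ω / (Ω * Subalgebra.toSubmodule (integralClosure R K)) =
      Submodule.map (Algebra.linearMap R K) (conductorIdeal R K) := by
    ext z
    rw [Submodule.mem_div_iff_forall_mul_mem]
    constructor
    · intro hz
      have h3 : ∀ b ∈ integralClosure R K, ∃ r, algebraMap R K r = z * b := by
        intro b hb
        rw [← Submodule.mem_one, ← h1, Submodule.mem_div_iff_forall_mul_mem]
        intro w hw
        rw [mul_assoc, mul_comm b w]
        exact hz _ (Submodule.mul_mem_mul hw hb)
      obtain ⟨c, hc⟩ := h3 1 (one_mem _)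
      rw [mul_one] at hc
      subst hc
      exact ⟨c, mem_conductorIdeal_iff.mpr h3, rfl⟩
    · rintro ⟨c, hc, rfl⟩ y hy
      refine Submodule.mul_induction_on hy (fun w hw b hb ↦ ?_) fun a b ha hb ↦ ?_
      · obtain ⟨r, hr⟩ := mem_conductorIdeal_iff.mp hc b hb
        rw [mul_comm w b, ← mul_assoc, Algebra.linearMap_apply, ← hr, ← Algebra.smul_def]
        exact Ω.smul_mem r hw
      · rw [mul_add]
        exact add_mem ha hb
  rw [← h2]
  exact div_div_eq_self hΩ hΩ0 hΩ1 (hfg.mul (Module.Finite.iff_fg.mp ‹_›))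

theorem mem_div_conductorTransform_iff (hR : ¬ IsField R) [Module.Finite R (integralClosure R K)]
    (hx : IsIdealReduction (Ideal.span {x}) (maximalIdeal R))
    (hC : conductorIdeal R K ≤ maximalIdeal R)
    (hΩ : Module.Baer R (K ⧸ Ω)) (hΩ0 : Ω ≠ ⊥) (hfg : Ω.FG) {z : K} :
    z ∈ Ω / Subalgebra.toSubmodule (conductorTransform R K x) ↔ z ∈ Ω ∧
      z / algebraMap R K x ∈ Ω * Subalgebra.toSubmodule (integralClosure R K) := by
  rw [← div_map_conductorIdeal hR hΩ hΩ0 hfg, Submodule.mem_div_iff_forall_mul_mem,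
    Submodule.mem_div_iff_forall_mul_mem]
  constructor
  · intro h
    refine ⟨by simpa using h 1 (one_mem (conductorTransform R K x)), ?_⟩
    rintro _ ⟨c, hc, rfl⟩
    rw [Algebra.linearMap_apply, div_mul_eq_mul_div, ← mul_div_assoc']
    exact h _ (Algebra.subset_adjoin ⟨c, hc, rfl⟩)
  · rintro ⟨h1, h2⟩ s hs
    obtain ⟨r, c, hc, rfl⟩ := (mem_conductorTransform_iff hR hx hC).mp hs
    rw [mul_add]
    refine add_mem ?_ ?_
    · rw [mul_comm, ← Algebra.smul_def]
      exact Ω.smul_mem r h1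
    · rw [mul_div_assoc', ← div_mul_eq_mul_div]
      exact h2 _ ⟨c, hc, rfl⟩

theorem div_conductorTransform_eq_map (hR : ¬ IsField R) [Module.Finite R (integralClosure R K)]
    (hx : IsIdealReduction (Ideal.span {x}) (maximalIdeal R))
    (hC : conductorIdeal R K ≤ maximalIdeal R) {ω : Ideal R} (hω : ω ≠ ⊥)
    (hΩ : Module.Baer R (K ⧸ Submodule.map (Algebra.linearMap R K) ω)) :
    Submodule.map (Algebra.linearMap R K) ω /
        Subalgebra.toSubmodule (conductorTransform R K x) =
      Submodule.map (Algebra.linearMap R K)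
        (ω ⊓ idealIntegralClosure (maximalIdeal R * ω) : Ideal R) := by
  have hinj : Function.Injective (Algebra.linearMap R K) := IsFractionRing.injective R K
  ext z
  rw [mem_div_conductorTransform_iff hR hx hC hΩ
    (fun h ↦ hω (Submodule.map_injective_of_injective hinj (h.trans (Submodule.map_bot _).symm)))
    ((IsNoetherian.noetherian ω).map _)]
  constructor
  · rintro ⟨⟨r, hr, rfl⟩, h⟩
    exact ⟨r, ⟨hr, (mem_idealIntegralClosure_maximalIdeal_mul_iff hR hx hω r).mpr h⟩, rfl⟩
  · rintro ⟨r, ⟨hr, h⟩, rfl⟩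
    exact ⟨⟨r, hr, rfl⟩, (mem_idealIntegralClosure_maximalIdeal_mul_iff hR hx hω r).mp h⟩

end Transform

/-! ### Length, dimension and generators of modules killed by m. -/

section ResidueRank

variable {k : Type v} [Field k] {R : Type u} [CommRing R] [IsLocalRing R] [Algebra k R]
  {M : Type u} [AddCommGroup M] [Module R M] [Module k M] [IsScalarTower k R M]

theorem exists_smul_eq_smul (hk : Function.Surjective (algebraMap k (ResidueField R)))
    (hM : ∀ r ∈ maximalIdeal R, ∀ z : M, r • z = 0) (r : R) :
    ∃ a : k, ∀ z : M, r • z = a • z := by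
  obtain ⟨a, ha⟩ := hk (residue R r)
  refine ⟨a, fun z ↦ ?_⟩
  rw [← sub_eq_zero, ← algebraMap_smul R a z, ← sub_smul]
  refine hM _ ?_ z
  rw [← residue_eq_zero_iff, map_sub, ← ha, sub_eq_zero]
  rfl

/-- Over a local ring with coefficient field `k`, a module killed by the maximal ideal has length
equal to its dimension over `k`. -/
theorem length_eq_toENat_rank (hk : Function.Surjective (algebraMap k (ResidueField R)))
    (hM : ∀ r ∈ maximalIdeal R, ∀ z : M, r • z = 0) :
    Module.length R M = (Module.rank k M).toENat := by
  rw [← Module.length_eq_rank]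
  apply WithBot.coe_injective
  rw [Module.coe_length, Module.coe_length]
  refine Order.krullDim_eq_of_orderIso
    (RelIso.ofSurjective (Submodule.restrictScalarsEmbedding k R M) fun N ↦ ?_)
  refine ⟨{ N with smul_mem' := fun r z hz ↦ ?_ }, rfl⟩
  obtain ⟨a, ha⟩ := exists_smul_eq_smul hk hM r
  rw [ha]
  exact N.smul_mem a hz

/-- Each r ∈ R acts as a scalar of k, so R-spans and k-spans coincide. -/
theorem minNumGenerators_eq_rank (hk : Function.Surjective (algebraMap k (ResidueField R)))
    (hM : ∀ r ∈ maximalIdeal R, ∀ z : M, r • z = 0) :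
    minNumGenerators R M = Module.rank k M := by
  rw [Submodule.rank_eq_spanRank_of_free, minNumGenerators]
  refine le_antisymm (Submodule.le_spanRank_restrictScalars (R := k) (⊤ : Submodule R M)) ?_
  obtain ⟨s, hs, hspan⟩ := (⊤ : Submodule R M).exists_span_set_card_eq_spanRank
  have h : Submodule.span k s = ⊤ := by
    rw [eq_top_iff]
    intro z _
    have hz : z ∈ Submodule.span R s := hspan ▸ trivial
    refine Submodule.span_induction (fun y hy ↦ Submodule.subset_span hy) (zero_mem _)
      (fun _ _ _ _ h h' ↦ add_mem h h') (fun r y _ hy ↦ ?_) hz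
    obtain ⟨a, ha⟩ := exists_smul_eq_smul hk hM r
    rw [ha]
    exact Submodule.smul_mem _ a hy
  rw [← hs, ← h]
  exact Submodule.spanRank_span_le_card s

end ResidueRank

/-! ### Identification with S/R and conclusion. -/

section Main

theorem smul_quotient_submoduleOf_eq_zero {R M : Type*} [CommRing R] [AddCommGroup M] [Module R M]
    {I J : Submodule R M} {r : R} (h : ∀ z ∈ J, r • z ∈ I) (z : J ⧸ I.submoduleOf J) :
    r • z = 0 := by
  obtain ⟨z, rfl⟩ := Submodule.mkQ_surjective _ z
  rw [← map_smul]
  exact (Submodule.Quotient.mk_eq_zero _).mpr (h z z.2)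

theorem le_idealIntegralClosure {R : Type u} [CommRing R] (I : Ideal R) :
    I ≤ idealIntegralClosure I := fun r hr ↦
  ⟨1, one_pos, fun i ↦ if i = 1 then -r else 0, fun i ↦ by
    dsimp only
    split_ifs with h
    · rw [h, pow_one]; exact neg_mem hr
    · exact zero_mem _, by simp⟩

/-- The quotient `J ⧸ I` is isomorphic to the quotient of the images under an injective map. -/
noncomputable def Submodule.quotientMapEquiv {R M N : Type*} [CommRing R] [AddCommGroup M]
    [Module R M] [AddCommGroup N] [Module R N] (f : M →ₗ[R] N) (hf : Function.Injective f)
    (I J : Submodule R M) :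
    (J ⧸ I.submoduleOf J) ≃ₗ[R] (J.map f ⧸ (I.map f).submoduleOf (J.map f)) :=
  Submodule.Quotient.equiv _ _ (Submodule.equivMapOfInjective f hf J) (by
    ext ⟨z, hz⟩
    obtain ⟨y, hy, rfl⟩ := hz
    constructor
    · rintro ⟨w, hw, hwz⟩
      exact ⟨w, hw, congrArg Subtype.val hwz⟩
    · rintro ⟨w, hw, hwz⟩
      obtain rfl := hf hwz
      exact ⟨⟨w, hy⟩, hw, rfl⟩)

variable {R : Type u} [CommRing R] [IsDomain R] [IsLocalRing R] [IsNoetherianRing R]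
  {K : Type u} [Field K] [Algebra R K] [IsFractionRing R K] {x : R}

/-- Division by `x` identifies `(C, x) / (x)` with `R[C / x] / R`. -/
theorem nonempty_quotient_equiv_conductorTransform (hR : ¬ IsField R)
    (hx : IsIdealReduction (Ideal.span {x}) (maximalIdeal R))
    (hC : conductorIdeal R K ≤ maximalIdeal R) :
    Nonempty ((↥(conductorIdeal R K ⊔ Ideal.span {x}) ⧸
      (Ideal.span {x}).submoduleOf (conductorIdeal R K ⊔ Ideal.span {x})) ≃ₗ[R]
      (↥(Subalgebra.toSubmodule (conductorTransform R K x)) ⧸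
        (1 : Submodule R K).submoduleOf
          (Subalgebra.toSubmodule (conductorTransform R K x)))) := by
  have hx0 : algebraMap R K x ≠ 0 := by simpa using ne_zero_of_isIdealReduction hR hx
  let f : R →ₗ[R] K := LinearMap.toSpanSingleton R K (algebraMap R K x)⁻¹
  have hf : ∀ r, f r = algebraMap R K r / algebraMap R K x := fun r ↦ by
    rw [LinearMap.toSpanSingleton_apply, Algebra.smul_def, div_eq_mul_inv]
  have hinj : Function.Injective f := fun a b hab ↦ by
    rw [hf, hf, div_left_inj' hx0] at hab
    exact IsFractionRing.injective R K hab
  have h1 : Submodule.map f (Ideal.span {x}) = 1 := by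
    ext z
    rw [Submodule.mem_one]
    constructor
    · rintro ⟨_, hr, rfl⟩
      obtain ⟨s, rfl⟩ := Ideal.mem_span_singleton'.mp hr
      exact ⟨s, by rw [hf, map_mul, mul_div_cancel_right₀ _ hx0]⟩
    · rintro ⟨s, rfl⟩
      exact ⟨s * x, Ideal.mem_span_singleton'.mpr ⟨s, rfl⟩, by
        rw [hf, map_mul, mul_div_cancel_right₀ _ hx0]⟩
  have h2 : Submodule.map f (conductorIdeal R K ⊔ Ideal.span {x}) =
      Subalgebra.toSubmodule (conductorTransform R K x) := by
    ext z
    rw [Subalgebra.mem_toSubmodule, mem_conductorTransform_iff hR hx hC]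
    constructor
    · rintro ⟨_, hr, rfl⟩
      obtain ⟨c, hc, _, hb, rfl⟩ := Submodule.mem_sup.mp hr
      obtain ⟨s, rfl⟩ := Ideal.mem_span_singleton'.mp hb
      refine ⟨s, c, hc, ?_⟩
      rw [hf, map_add, map_mul]
      field_simp
      ring
    · rintro ⟨s, c, hc, rfl⟩
      refine ⟨c + s * x, Submodule.add_mem_sup hc (Ideal.mem_span_singleton'.mpr ⟨s, rfl⟩), ?_⟩
      rw [hf, map_add, map_mul]
      field_simp
      ring
  rw [← h1, ← h2]
  exact ⟨Submodule.quotientMapEquiv f hinj _ _⟩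

end Main

theorem mainTheorem7
    {k : Type v} [Field k] [IsAlgClosed k] [CharZero k]
    {R : Type u} [CommRing R] [IsDomain R] [IsLocalRing R] [IsNoetherianRing R]
    [IsAdicComplete (maximalIdeal R) R] [Algebra k R]
    (hk : Function.Bijective (algebraMap k (ResidueField R)))
    (hdim : ringKrullDim R = 1)
    {K : Type u} [Field K] [Algebra R K] [IsFractionRing R K]
    (hC : conductorIdeal R K ≤ maximalIdeal R ^ 2)
    (x : R) (hx : IsIdealReduction (Ideal.span {x}) (maximalIdeal R))
    (ω : Ideal R) (hω : IsCanonicalModule R ω) :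
    (∃ (_ : IsLocalRing (conductorTransform R K x))
      (W : Submodule (conductorTransform R K x) K),
        (W : Set K) =
          algebraMap R K '' (ω ⊓ idealIntegralClosure (maximalIdeal R * ω) : Ideal R) ∧
        IsCanonicalModule (conductorTransform R K x) W) ∧
    reducedType k R K x =
      minNumGenerators R
        (ω ⧸ (ω ⊓ idealIntegralClosure (maximalIdeal R * ω)).submoduleOf ω) := by
  have := dimensionLEOne_of_ringKrullDim_eq_one hdim
  have hR := not_isField_of_ringKrullDim_eq_one hdim
  have hC' := hC.trans (Ideal.pow_le_self two_ne_zero)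
  have hxm := mem_maximalIdeal_of_isIdealReduction hx
  have := finite_integralClosure (K := K) hR hx
  have := finite_conductorTransform (K := K) hR hx hC'
  have hinj : Function.Injective (Algebra.linearMap R K) := IsFractionRing.injective R K
  have hω0 : ω ≠ ⊥ := by
    obtain ⟨-, rs, -, hrs, -⟩ := hω.isMaximalCohenMacaulay
    have := hrs.nontrivial
    exact Submodule.nontrivial_iff_ne_bot.mp this
  let Ω : Submodule R K := Submodule.map (Algebra.linearMap R K) ω
  have hΩfg : Ω.FG := (IsNoetherian.noetherian ω).map _
  have hΩ0 : Ω ≠ ⊥ := fun h ↦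
    hω0 (Submodule.map_injective_of_injective hinj (h.trans (Submodule.map_bot _).symm))
  have hΩ1 : Ω ≠ ⊤ := Submodule.ne_top_of_fg_of_isFractionRing hR hΩfg
  have hΩ : Module.Baer R (K ⧸ Ω) := by
    obtain ⟨d, hd⟩ := hω.finite_injectiveDimension
    refine baer_quotient_of_hasInjectiveDimensionLE hR (baer_fractionRing R K) Ω d ?_
    exact (ModuleCat.hasInjectiveDimensionLE_iff_of_linearEquiv
      (M := ModuleCat.of R ω) (N := ModuleCat.of R Ω)
      (Submodule.equivMapOfInjective (Algebra.linearMap R K) hinj ω) d).mp hd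
  let S := conductorTransform R K x
  have hdiv : Ω / Subalgebra.toSubmodule S = Submodule.map (Algebra.linearMap R K)
      (ω ⊓ idealIntegralClosure (maximalIdeal R * ω) : Ideal R) :=
    div_conductorTransform_eq_map hR hx hC' hω0 hΩ
  constructor
  · have hloc := isLocalRing_conductorTransform hR hx hC
    let W : Submodule S K :=
      { carrier := (Ω / Subalgebra.toSubmodule S : Submodule R K)
        add_mem' := fun ha hb ↦ add_mem ha hb
        zero_mem' := zero_mem _
        smul_mem' := fun s z hz ↦ by
          rw [SetLike.mem_coe, Submodule.mem_div_iff_forall_mul_mem] at hz ⊢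
          intro t ht
          rw [Subalgebra.smul_def, smul_eq_mul, mul_comm (s : K) z, mul_assoc]
          exact hz _ (S.mul_mem s.2 ht) }
    have hWR : W.restrictScalars R = Ω / Subalgebra.toSubmodule S := rfl
    refine ⟨hloc, W, congrArg (fun N : Submodule R K ↦ (N : Set K)) hdiv, ?_⟩
    have := isFractionRing_subalgebra S
    have : IsNoetherianRing S := IsNoetherianRing.of_finite R S
    refine isCanonicalModule_of_baer_quotient (ringKrullDim_subalgebra_eq_one hR S)
      (baer_quotient_of_subalgebra hΩ S W hWR) ?_ fun hW ↦ ?_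
    · apply Submodule.FG.of_restrictScalars R
      rw [hWR, hdiv]
      exact (IsNoetherian.noetherian _).map _
    · obtain ⟨a, ha, ha0⟩ := Submodule.exists_mem_ne_zero_of_ne_bot hω0
      have hx1 := ne_zero_of_isIdealReduction hR hx
      -- The nonzero witness: xa lies in mω, hence in its integral closure.
      have hmem : x * a ∈ ω ⊓ idealIntegralClosure (maximalIdeal R * ω) :=
        ⟨Ideal.mul_mem_left _ _ ha, le_idealIntegralClosure _ (Ideal.mul_mem_mul hxm ha)⟩
      have h1 : algebraMap R K (x * a) ∈ W.restrictScalars R := by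
        rw [hWR, hdiv]
        exact ⟨_, hmem, rfl⟩
      rw [hW, Submodule.restrictScalars_mem, Submodule.mem_bot] at h1
      exact mul_ne_zero hx1 ha0 (by simpa using h1)
  -- For c ∈ C, rc = x · c(r/x), and c(r/x) ∈ R because r/x is integral.
  · have hker1 : ∀ r ∈ maximalIdeal R, ∀ z : (↥(conductorIdeal R K ⊔ Ideal.span {x}) ⧸
        (Ideal.span {x}).submoduleOf (conductorIdeal R K ⊔ Ideal.span {x})), r • z = 0 := by
      refine fun r hr ↦ smul_quotient_submoduleOf_eq_zero fun z hz ↦ ?_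
      obtain ⟨c, hc, b, hb, rfl⟩ := Submodule.mem_sup.mp hz
      rw [smul_add]
      refine add_mem ?_ (Submodule.smul_mem _ r hb)
      obtain ⟨s, hs⟩ := mem_conductorIdeal_iff.mp hc _
        (div_mem_integralClosure_of_isIdealReduction (K := K) hR hx hr)
      have hx0 : algebraMap R K x ≠ 0 := by simpa using ne_zero_of_isIdealReduction hR hx
      refine Ideal.mem_span_singleton'.mpr ⟨s, IsFractionRing.injective R K ?_⟩
      rw [map_mul, hs, smul_eq_mul, map_mul]
      field_simp
    have hker2 : ∀ r ∈ maximalIdeal R, ∀ z :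
        (ω ⧸ (ω ⊓ idealIntegralClosure (maximalIdeal R * ω)).submoduleOf ω), r • z = 0 :=
      fun r hr ↦ smul_quotient_submoduleOf_eq_zero fun z hz ↦
        ⟨Ideal.mul_mem_left _ _ hz, le_idealIntegralClosure _ (Ideal.mul_mem_mul hr hz)⟩
    obtain ⟨e⟩ := nonempty_quotient_equiv_conductorTransform (K := K) hR hx hC'
    -- Duality for R ⊆ S, where Ω : R = Ω.
    have hlen := length_quotient_eq_length_div_quotient_div hΩ hΩ0 hΩ1 (I := 1)
      (J := Subalgebra.toSubmodule S) (Submodule.one_le.mpr S.one_mem)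
      (Module.Finite.iff_fg.mp ‹_›) (by rwa [Submodule.div_one_eq])
    rw [Submodule.div_one_eq, hdiv, ← e.length_eq,
      ← (Submodule.quotientMapEquiv (Algebra.linearMap R K) hinj _ _).length_eq,
      length_eq_toENat_rank hk.2 hker1, length_eq_toENat_rank hk.2 hker2] at hlen
    rw [minNumGenerators_eq_rank hk.2 hker2]
    -- Lengths compare ranks only after `toENat`, which identifies all infinite cardinals;
    -- finiteness of one side restores the equality of cardinals.
    have hfin : Module.rank k
        (ω ⧸ (ω ⊓ idealIntegralClosure (maximalIdeal R * ω)).submoduleOf ω) <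
          Cardinal.aleph0 := by
      rw [← minNumGenerators_eq_rank hk.2 hker2]
      exact Submodule.spanRank_finite_iff_fg.mpr (IsNoetherian.noetherian _)
    obtain ⟨n, hn⟩ := Cardinal.lt_aleph0.mp hfin
    rw [hn, Cardinal.toENat_nat, Cardinal.toENat_eq_natCast] at hlen
    rw [hn]
    exact hlen
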